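/- **Setup.** Let $N$ be a lattice with a basis $(e_i)_{i\in I}$, $I$ finite, and a skew-symmetric form $\{\,,\}\colon N\times N\to\mathbb Z$; let $M=\mathrm{Hom}(N,\mathbb Z)$. Let $N^+$ be the set of nonzero combinations of the $e_i$ with coefficients in $\mathbb Z_{\ge0}$, $\mathfrak g=\bigoplus_{n\in N^+}\mathbb C z^n$ with $[z^n,z^{n'}]=-\{n,n'\}z^{n+n'}$, let $\hat{\mathfrak g}=\prod_{n\in N^+}\mathbb Cz^n$ be its completion and $G=\exp(\hat{\mathfrak g})$ the corresponding pro-unipotent group. Let $P\subset M\oplus N$ be the monoid generated by the vectors $(e_i^*,0)$ and $(\{e_i,\cdot\},e_i)$. The Lie algebra $\hat{\mathfrak g}$ acts on each $z^{(m,n)}\widehat{\mathbb C[P]}$ by the log derivations $z^{n'}\circ z^{(m,n)}=\langle n',m\rangle\, z^{(m+\{n',\cdot\},\,n+n')}$, and $G$ acts by exponentiating. Let $\Pi$ be a group acting on $I$ with $\{e_{\pi i},e_{\pi'j}\}=\{e_i,e_j\}$ for all $i,j\in I$ and $\pi,\pi'\in\Pi$. It acts on $N$ by $\pi\cdot e_i=e_{\pi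 i}$, and on $\mathfrak g$ and $G$ through $\pi\cdot z^n=z^{\pi n}$; let $G^\Pi$ be the subgroup of invariant elements. Let $\overline N$ be the lattice with basis $e_{\Pi i}$ indexed by the orbits, with the form $\{e_{\Pi i},e_{\Pi j}\}=\{e_i,e_j\}$, and let $q\colon N\to\overline N$, $e_i\mapsto e_{\Pi i}$. Put $d_{\Pi i}=|\Pi i|$, let $\overline N^\circ\subset\overline N$ be the sublattice with basis $d_{\Pi i}e_{\Pi i}$, and $\overline M^\circ=\mathrm{Hom}(\overline N^\circ,\mathbb Z)$. Define $\overline{\mathfrak g}$, $\overline G$, $\overline P\subset\overline M^\circ\oplus\overline N$ (generated by $(e_{\Pi i}^*/d_{\Pi i},0)$ and $(\{e_{\Pi i},\cdot\},e_{\Pi i})$) and the action of $\overline G$ on $z^{(m',n')}\widehat{\mathbb C[\overline P]}$ for $(m',n')\in\overline M^\circ\oplus\overline N$ in the same way, where the pairing of $\overline N$ with $\overline M^\circ$ is the $\mathbb Q$-valued one. The map $z^n\mapsto z^{q(n)}$ induces a homomorphism $G\to\overline G$, $g\mapsto\overline g$. Let $s\colon\overline N^\circ\to N$, $d_{\Pi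 i}e_{\Pi i}\mapsto\sum_{i'\in\Pi i}e_{i'}$, with dual $s^*\colon M\to\overline M^\circ$, and write $(\overline m,\overline n)=(s^*(m),q(n))$. The surjection $(s^*,q)\colon M\oplus N\to\overline M^\circ\oplus\overline N$ induces an embedding of tori $\phi=\phi_{(s^*,q)}\colon T_{\overline N^\circ\oplus\overline M}\hookrightarrow T_{N\oplus M}$ and the pullback $\phi^*$, $z^{(m,n)}\mapsto z^{(\overline m,\overline n)}$, of Laurent polynomials and of formal series $z^{(m,n)}\widehat{\mathbb C[P]}\to z^{(\overline m,\overline n)}\widehat{\mathbb C[\overline P]}$. We say that $g\in G$ *induces* the $\mathbb C$-automorphism $\psi$ of $\mathbb C(M\oplus N)=\mathrm{Frac}\,\mathbb C[M\oplus N]$ if for each Laurent polynomial $x$ the series $g\cdot x$ is the expansion of the rational function $\psi(x)$; here a series $F\in z^{(m,n)}\widehat{\mathbb C[P]}$ (for some $(m,n)$) is the expansion of $a/b$ if $bF=a$. Similarly for $\overline G$ and $\mathbb C(\overline M^\circ\oplus\overline N)$. **Proposition 3.3.** Let $g\in G^\Pi$ induce an automorphism $\psi$ of the function field $\mathbb C(M\oplus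 N)$. Then $\overline g$ induces an automorphism $\overline\psi$ of $\mathbb C(\overline M^\circ\oplus\overline N)$. Moreover, the actions commute with $\phi$: 1. for all $(m,n)\in M\oplus N$, $\ \overline g\cdot z^{(\overline m,\overline n)}=\phi^*\big(g\cdot z^{(m,n)}\big)$ as formal series; 2. the birational automorphisms $\varphi_g$ of $T_{N\oplus M}$ and $\varphi_{\overline g}$ of $T_{\overline N^\circ\oplus\overline M}$ given by $\psi$ and $\overline\psi$ satisfy $\varphi_g\circ\phi=\phi\circ\varphi_{\overline g}$: if a rational function $h\in\mathbb C(M\oplus N)$ is regular at the generic point of the image of $\phi$ (that is, $h=a/b$ with $a,b\in\mathbb C[M\oplus N]$ and $\phi^*(b)\ne0$), then so is $\psi(h)$, and $\phi^*(\psi(h))=\overline\psi(\phi^*(h))$, where $\phi^*(a/b)=\phi^*(a)/\phi^*(b)$. -/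

import Mathlib

/-!
Folding of a skew-symmetric seed and the action of the associated pro-unipotent groups on
formal Laurent series and on function fields.
-/

/-! ## Lattices with log derivations

The constructions below are made once and then used twice: for the lattices `N`, `M` of the
original seed and for the lattices of the folded seed. -/

/-- The lattice data which the Lie algebra, its group and their action by log derivations are built
from: `e` is the seed (a basis of `N`), `f` the basis of the character lattice `M` that
spans, together with `(p (e i), e i)`, the cone `σ`; `pairing` is `⟨n, m⟩`; `p n` is `{n, ·}`. -/
structure LatticeDatum (I N M : Type*) [AddCommGroup N] [AddCommGroup M] where
  e : Module.Basis I ℤ N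
  f : Module.Basis I ℤ M
  pairing : N →+ M →+ ℂ
  p : N →+ M

namespace LatticeDatum

variable {I N M : Type*} [AddCommGroup N] [AddCommGroup M] (T : LatticeDatum I N M)

/-- `N⁺`: the nonzero nonnegative integer combinations of the seed vectors. -/
def pos : Set N := {n | n ≠ 0 ∧ ∀ i, 0 ≤ T.e.repr n i}

/-- The completed Lie algebra `ĝ`. Since `g = ⨁_{n ∈ N⁺} ℂ z^n` and there are only finitely many
`n ∈ N⁺` of each degree, the limit of the quotients `g / g^{>k}` is the space of
all formal sums `∑_{n ∈ N⁺} f_n z^n`; such a sum is recorded by its coefficients. -/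
abbrev LieHat : Type _ := T.pos → ℂ

/-- The pro-unipotent group `G = exp ĝ`; `exp : ĝ → G` is a bijection with inverse `log`. (The
group law, given by the Baker-Campbell-Hausdorff formula, is not needed here.) -/
@[ext] structure ProGroup where
  exp ::
  log : T.LieHat

/-- The monoid `P = σ ∩ (M ⊕ N)`. The vectors `(f i, 0)` and `(p (e i), e i)` that span `σ` form a
basis of `M ⊕ N`, so `P` is the monoid which they generate. -/
def P : AddSubmonoid (M × N) :=
  AddSubmonoid.closure
    (Set.range (fun i => (T.f i, (0 : N))) ∪ Set.range (fun i => (T.p (T.e i), T.e i)))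

/-- Formal series `F = ∑ F(μ) z^μ` that lie in `z^ν ℂ[P]^` for some `ν ∈ M ⊕ N`. -/
def IsLaurent (F : M × N → ℂ) : Prop := ∃ ν : M × N, ∀ μ, F μ ≠ 0 → μ - ν ∈ T.P

/-- The action of `ĝ` by log derivations,
`z^n ∘ z^(m, n') = ⟨n, m⟩ z^(m + {n, ·}, n' + n)`, extended to formal series.
For a series as in `IsLaurent` all the sums are finite. -/
noncomputable def lieAct (f : T.LieHat) (F : M × N → ℂ) : M × N → ℂ := fun μ =>
  ∑ᶠ n : T.pos, f n * T.pairing n (μ.1 - T.p n) * F (μ.1 - T.p n, μ.2 - n)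

/-- The action of `g = exp f ∈ G`, that is `F ↦ ∑_k (1/k!) (f ∘ ⋯ ∘ f ∘ F)`. For a series as in
`IsLaurent` each coefficient of the result is a finite sum. -/
noncomputable def act (g : T.ProGroup) (F : M × N → ℂ) : M × N → ℂ := fun μ =>
  ∑ᶠ k : ℕ, (k.factorial : ℂ)⁻¹ * ((T.lieAct g.log)^[k] F) μ

end LatticeDatum

/-- The function field `ℂ(Λ)` of the torus with character lattice `Λ`. -/
abbrev LatticeField (Λ : Type*) [AddCommGroup Λ] : Type _ := FractionRing (AddMonoidAlgebra ℂ Λ)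

/-- A Laurent polynomial in `ℂ[Λ]`, seen in its function field. -/
noncomputable def toField {Λ : Type*} [AddCommGroup Λ] (x : AddMonoidAlgebra ℂ Λ) :
    LatticeField Λ :=
  algebraMap (AddMonoidAlgebra ℂ Λ) (LatticeField Λ) x

/-- The monomial `z^μ` as a Laurent polynomial. -/
noncomputable def zpoly {Λ : Type*} [AddCommGroup Λ] (μ : Λ) : AddMonoidAlgebra ℂ Λ :=
  AddMonoidAlgebra.single μ 1

/-- A Laurent polynomial, seen as a formal series. -/
def toSeries {Λ : Type*} [AddCommGroup Λ] (x : AddMonoidAlgebra ℂ Λ) : Λ → ℂ := fun μ => x.coeff μ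

/-- The product of a Laurent polynomial and a formal series. -/
def mulSeries {Λ : Type*} [AddCommGroup Λ] (b : AddMonoidAlgebra ℂ Λ) (F : Λ → ℂ) : Λ → ℂ :=
  fun μ => ∑ ν ∈ b.coeff.support, b.coeff ν * F (μ - ν)

namespace LatticeDatum

variable {I N M : Type*} [AddCommGroup N] [AddCommGroup M] (T : LatticeDatum I N M)

/-- The rational function `h = a / b` has the formal series `F` as its expansion: `b F = a`. -/
def IsExpansion (h : LatticeField (M × N)) (F : M × N → ℂ) : Prop :=
  T.IsLaurent F ∧ ∃ a b : AddMonoidAlgebra ℂ (M × N),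
    b ≠ 0 ∧ h * toField b = toField a ∧ mulSeries b F = toSeries a

/-- `g` induces the automorphism `ψ` of the function field `ℂ(M ⊕ N)`: on Laurent polynomials, `ψ`
is the action of `g` (so that `g · x` is the expansion of a rational function). -/
def Induces (g : T.ProGroup) (ψ : LatticeField (M × N) ≃ₐ[ℂ] LatticeField (M × N)) : Prop :=
  ∀ x : AddMonoidAlgebra ℂ (M × N), T.IsExpansion (ψ (toField x)) (T.act g (toSeries x))

end LatticeDatum

/-! ## The original seed -/

section Seed

variable {I N : Type*} [Finite I] [AddCommGroup N]

/-- The datum of the seed `e` of `N` with skew-symmetric form `B`: here `M = Hom(N, ℤ)` with the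
dual basis, the evaluation pairing, and `{n, ·} = B n`. -/
noncomputable def seedDatum (e : Module.Basis I ℤ N) (B : N →ₗ[ℤ] N →ₗ[ℤ] ℤ) :
    LatticeDatum I N (Module.Dual ℤ N) :=
  letI := Classical.decEq I
  { e := e
    f := e.dualBasis
    pairing :=
      { toFun := fun n => (Int.castAddHom ℂ).comp (LinearMap.applyₗ n).toAddMonoidHom
        map_zero' := by ext m; simp
        map_add' := fun n n' => by ext m; simp }
    p := B.toAddMonoidHom }

end Seed

/-! ## The folded seed -/

section Fold

variable {I N : Type*} [AddCommGroup N]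
variable (Γ : Type*) [Group Γ] [MulAction Γ I]

/-- The set `Ī` of orbits of the symmetry group on the index set. -/
abbrev OrbitIndex (Γ I : Type*) [Group Γ] [MulAction Γ I] : Type _ :=
  MulAction.orbitRel.Quotient Γ I

/-- The orbit of an index. -/
def orbitOf (i : I) : OrbitIndex Γ I := Quotient.mk (MulAction.orbitRel Γ I) i

/-- The lattice `N̄`, with basis `e_x` indexed by the orbits `x`. -/
abbrev FoldN (Γ I : Type*) [Group Γ] [MulAction Γ I] : Type _ := OrbitIndex Γ I →₀ ℤ

/-- The seed of `N̄`. -/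
noncomputable def foldBasis : Module.Basis (OrbitIndex Γ I) ℤ (FoldN Γ I) :=
  Finsupp.basisSingleOne

/-- `q : N → N̄`, sending `e_i` to the basis vector of the orbit of `i`. -/
noncomputable def foldQ (e : Module.Basis I ℤ N) : N →ₗ[ℤ] FoldN Γ I :=
  e.constr ℤ fun i => foldBasis Γ (orbitOf Γ i)

/-- The form on `N̄`: its value on two basis vectors is that of `B` on representatives
of the two orbits. (By `foldForm_foldQ` it does not depend on the representatives.) -/
noncomputable def foldForm (e : Module.Basis I ℤ N) (B : N →ₗ[ℤ] N →ₗ[ℤ] ℤ) :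
    FoldN Γ I →ₗ[ℤ] FoldN Γ I →ₗ[ℤ] ℤ :=
  (foldBasis Γ).constr ℤ fun x => (foldBasis Γ).constr ℤ fun y => B (e x.out) (e y.out)

theorem foldForm_foldQ (e : Module.Basis I ℤ N) (B : N →ₗ[ℤ] N →ₗ[ℤ] ℤ)
    (hB : ∀ (π π' : Γ) (i j : I), B (e (π • i)) (e (π' • j)) = B (e i) (e j)) (n n' : N) :
    foldForm Γ e B (foldQ Γ e n) (foldQ Γ e n') = B n n' := by
  have key : ((foldForm Γ e B).compl₁₂ (foldQ Γ e) (foldQ Γ e)) = B := by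
    refine e.ext fun i => e.ext fun j => ?_
    obtain ⟨π, hπ⟩ : (orbitOf Γ i).out ∈ MulAction.orbit Γ i :=
      Quotient.exact (s := MulAction.orbitRel Γ I) (Quotient.out_eq (orbitOf Γ i))
    obtain ⟨π', hπ'⟩ : (orbitOf Γ j).out ∈ MulAction.orbit Γ j :=
      Quotient.exact (s := MulAction.orbitRel Γ I) (Quotient.out_eq (orbitOf Γ j))
    simp only [LinearMap.compl₁₂_apply, foldForm, foldQ, Module.Basis.constr_basis]
    rw [← hπ, ← hπ']
    exact hB π π' i j
  exact congrArg (fun b => b n n') key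

variable [Finite I]

/-- `d_x`, the number of seed vectors `e_i` over the basis vector of the orbit `x`. -/
noncomputable def orbitCard (x : OrbitIndex Γ I) : ℕ := Nat.card {i : I // orbitOf Γ i = x}

theorem orbitCard_ne_zero (x : OrbitIndex Γ I) : orbitCard Γ x ≠ 0 :=
  Nat.card_ne_zero.2 ⟨⟨x.out, Quotient.out_eq x⟩, inferInstance⟩

/-- The vectors `d_x e_x` of `N̄`. -/
noncomputable def foldVec (x : OrbitIndex Γ I) : FoldN Γ I := (orbitCard Γ x : ℤ) • foldBasis Γ x

theorem foldVec_linearIndependent : LinearIndependent ℤ (foldVec (I := I) Γ) := by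
  rw [linearIndependent_iff]
  intro l hl
  ext x
  have h := DFunLike.congr_fun hl x
  rw [Finsupp.linearCombination_apply, Finsupp.sum, Finsupp.finsetSum_apply,
    Finset.sum_eq_single x] at h
  · simpa [foldVec, foldBasis, orbitCard_ne_zero] using h
  · intro y _ hy
    simp [foldVec, foldBasis, hy]
  · intro hx
    simp [Finsupp.notMem_support_iff.1 hx]

/-- The sublattice `N̄° ⊆ N̄` with basis `d_x e_x`. -/
noncomputable abbrev FoldNo (Γ I : Type*) [Group Γ] [MulAction Γ I] : Submodule ℤ (FoldN Γ I) :=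
  Submodule.span ℤ (Set.range (foldVec (I := I) Γ))

/-- The basis `d_x e_x` of `N̄°`. -/
noncomputable def foldNoBasis : Module.Basis (OrbitIndex Γ I) ℤ (FoldNo Γ I) :=
  Module.Basis.span (foldVec_linearIndependent Γ)

/-- `M̄° = Hom(N̄°, ℤ)`. -/
abbrev FoldMo (Γ I : Type*) [Group Γ] [MulAction Γ I] : Type _ := Module.Dual ℤ (FoldNo Γ I)

/-- The section `s` restricted to `N̄° → N`: `d_x e_x ↦ ∑_{i ∈ x} e_i`. -/
noncomputable def foldS (e : Module.Basis I ℤ N) : FoldNo Γ I →ₗ[ℤ] N :=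
  (foldNoBasis Γ).constr ℤ fun x => ∑ᶠ i : {i : I // orbitOf Γ i = x}, e i

/-- `s^* : M → M̄°`, the dual of `s`. -/
noncomputable def foldSDual (e : Module.Basis I ℤ N) : Module.Dual ℤ N →ₗ[ℤ] FoldMo Γ I :=
  (foldS Γ e).dualMap

/-- The pairing of `N̄` with `M̄°`: the element `m` of `M̄° = Hom(N̄°, ℤ)` is extended linearly to
`N̄`, with rational values `⟨e_x, m⟩ = m (d_x e_x) / d_x`. -/
noncomputable def foldPairing : FoldN Γ I →+ FoldMo Γ I →+ ℂ :=
  Finsupp.liftAddHom fun x =>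
    { toFun := fun a =>
        { toFun := fun m => (a : ℂ) * ((m (foldNoBasis Γ x) : ℂ) / (orbitCard Γ x : ℂ))
          map_zero' := by simp
          map_add' := fun m m' => by simp; ring }
      map_zero' := by ext m; simp
      map_add' := fun a a' => by ext m; simp; ring }

/-- The datum of the folded seed: the lattices `N̄` and `M̄°`, the seed `e_x`, the basis of `M̄°`
dual to `d_x e_x` (that is `e_x^* / d_x`), and `{n, ·}` restricted to `N̄°`. -/
noncomputable def foldDatum (e : Module.Basis I ℤ N) (B : N →ₗ[ℤ] N →ₗ[ℤ] ℤ) :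
    LatticeDatum (OrbitIndex Γ I) (FoldN Γ I) (FoldMo Γ I) :=
  letI := Classical.decEq (OrbitIndex Γ I)
  { e := foldBasis Γ
    f := (foldNoBasis Γ).dualBasis
    pairing := foldPairing Γ
    p := ((FoldNo Γ I).subtype.dualMap ∘ₗ foldForm Γ e B).toAddMonoidHom }

/-- The action of the symmetry group on `N`: `π · e_i = e_{π · i}`. -/
noncomputable def actN (e : Module.Basis I ℤ N) (π : Γ) : N ≃ₗ[ℤ] N :=
  e.equiv e (MulAction.toPerm π)

theorem actN_mem_pos (e : Module.Basis I ℤ N) (B : N →ₗ[ℤ] N →ₗ[ℤ] ℤ) (π : Γ) {n : N}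
    (hn : n ∈ (seedDatum e B).pos) : actN Γ e π n ∈ (seedDatum e B).pos := by
  refine ⟨fun h => hn.1 ((actN Γ e π).map_eq_zero_iff.1 h), fun i => ?_⟩
  have h1 : (e.reindex (MulAction.toPerm π).symm).repr (actN Γ e π n) = e.repr n :=
    (e.reindex (MulAction.toPerm π).symm).repr.apply_symm_apply (e.repr n)
  have h2 := DFunLike.congr_fun h1 (π⁻¹ • i)
  simp only [Module.Basis.repr_reindex_apply, Equiv.symm_symm, MulAction.toPerm_apply,
    smul_inv_smul] at h2
  exact h2 ▸ hn.2 (π⁻¹ • i)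

/-- The action on `G`, `π · exp f = exp (π · f)` with `π · z^n = z^(π · n)` on `ĝ`; so the
coefficient of `π · f` at `n` is that of `f` at `π⁻¹ · n`. -/
noncomputable def actGroup (e : Module.Basis I ℤ N) (B : N →ₗ[ℤ] N →ₗ[ℤ] ℤ) (π : Γ)
    (g : (seedDatum e B).ProGroup) : (seedDatum e B).ProGroup :=
  ⟨fun n => g.log ⟨actN Γ e π⁻¹ n, actN_mem_pos Γ e B π⁻¹ n.2⟩⟩

/-- The part of `G` that is invariant under the symmetry group. -/
def invariantGroup (e : Module.Basis I ℤ N) (B : N →ₗ[ℤ] N →ₗ[ℤ] ℤ) :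
    Set (seedDatum e B).ProGroup :=
  {g | ∀ π : Γ, actGroup Γ e B π g = g}

/-- The quotient map `G → Ḡ`, `exp f ↦ exp (q̃ f)` with `q̃ (z^n) = z^(q n)`; the coefficient of
`q̃ f` at `n̄` is the sum, which is finite, of those of `f` at the `n ∈ N⁺` over `n̄`. -/
noncomputable def foldGroup (e : Module.Basis I ℤ N) (B : N →ₗ[ℤ] N →ₗ[ℤ] ℤ)
    (g : (seedDatum e B).ProGroup) : (foldDatum Γ e B).ProGroup :=
  ⟨fun x => ∑ᶠ n : {n : (seedDatum e B).pos // foldQ Γ e n = x}, g.log n⟩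

/-- The map `(s^*, q) : M ⊕ N → M̄° ⊕ N̄`, `(m, n) ↦ (m̄, n̄)`. -/
noncomputable def foldSQ (e : Module.Basis I ℤ N) :
    Module.Dual ℤ N × N →+ FoldMo Γ I × FoldN Γ I :=
  ((foldSDual Γ e).prodMap (foldQ Γ e)).toAddMonoidHom

/-- The pullback `φ^*` of Laurent polynomials along the embedding of tori `φ` given by `(s^*, q)`:
`z^(m, n) ↦ z^(m̄, n̄)`. -/
noncomputable def pullPoly (e : Module.Basis I ℤ N) :
    AddMonoidAlgebra ℂ (Module.Dual ℤ N × N) →+* AddMonoidAlgebra ℂ (FoldMo Γ I × FoldN Γ I) :=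
  AddMonoidAlgebra.mapDomainRingHom ℂ (foldSQ Γ e)

/-- The pullback `φ^* : z^(m, n) ℂ[P]^ → z^(m̄, n̄) ℂ[P̄]^` of formal series,
`∑ F(μ) z^μ ↦ ∑ F(μ) z^μ̄`; all the sums are finite. -/
noncomputable def pullSeries (e : Module.Basis I ℤ N) (F : Module.Dual ℤ N × N → ℂ) :
    FoldMo Γ I × FoldN Γ I → ℂ :=
  fun x => ∑ᶠ μ : {μ : Module.Dual ℤ N × N // foldSQ Γ e μ = x}, F μ

/-- The pullback `φ^*` of rational functions, which is only partially defined: `h` is regular at the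
generic point of the image of `φ`, and its restriction along `φ` is `h'`. -/
def PullsBackTo (e : Module.Basis I ℤ N) (h : LatticeField (Module.Dual ℤ N × N))
    (h' : LatticeField (FoldMo Γ I × FoldN Γ I)) : Prop :=
  ∃ a b : AddMonoidAlgebra ℂ (Module.Dual ℤ N × N), pullPoly Γ e b ≠ 0 ∧
    h * toField b = toField a ∧ h' * toField (pullPoly Γ e b) = toField (pullPoly Γ e a)

end Fold

/-! The vectors `(f i, 0)` and `(p (e i), e i)` form a basis of `M × N`, so `P` is free and a series
in `z^ν ℂ[P]^` is a shifted power series. Every `n ∈ N⁺` has positive degree there; hence `ĝ` raises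
degrees, and an element of `G` acts as the identity plus a degree-raising operator, bijectively on
each `z^ν ℂ[P]^`. Since `(s^*, q)` carries basis vectors to basis vectors, `φ^*` merely identifies
variables and keeps degrees and constant terms.

Equivariance on series comes down to `sum_fiber_pairing`. For invariant `f` the sum of `f_n ⟨n,
e_i^*⟩` over `q n = n̄` depends only on the orbit of `i`, so it may be averaged over that orbit; the
average is `(∑ f_n) ⟨n̄, s^* e_i^*⟩`, its factor `1/d` being the one in the pairing of `N̄` with
`M̄°`. Exponentiating gives the first claim (`act_pushSeries`).

For rational functions the danger is a denominator of `ψ(x)` that vanishes on the subtorus. Krull's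
intersection theorem removes it: if `B F = A` with polynomials `A`, `B` and a power series `F`, then
`A / B = c / r` with `r(0) = 1` (`exists_normalForm`). The constant term survives `φ^*`, so `ψ(x)`
is regular at the generic point of the subtorus, and its restriction has the expansion `φ^*(g · x) =
ḡ · φ^* x`. As `ḡ` acts injectively, the restriction vanishes exactly when `φ^* x` does. The same
holds for `ψ⁻¹`, because the preimage of `x` under `g` expands `ψ⁻¹(x)`; this uses that `g` is
multiplicative on series, which is inherited from `ψ` on Laurent polynomials and extended by
truncation. So `ψ` and `ψ⁻¹` preserve the local ring at that generic point and its maximal ideal,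
and `ψ̄` is the induced automorphism of the residue field `ℂ(M̄° ⊕ N̄)`. -/

/-! ## Series supported in a translate of a simplicial cone -/

section Cone

variable {J Λ : Type*} [AddCommGroup Λ] (β : Module.Basis J ℤ Λ)

/-- The lattice vector with the given nonnegative coordinates in the basis `β`. -/
noncomputable def coneHom : (J →₀ ℕ) →+ Λ :=
  β.repr.symm.toLinearMap.toAddMonoidHom.comp
    (Finsupp.mapRange.addMonoidHom (Nat.castAddMonoidHom ℤ))

theorem repr_coneHom (α : J →₀ ℕ) (j : J) : β.repr (coneHom β α) j = α j := by
  simp [coneHom]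

theorem coneHom_injective : Function.Injective (coneHom β) := fun α α' h => by
  ext j
  have := repr_coneHom β α j
  rw [h, repr_coneHom] at this
  exact_mod_cast this.symm

theorem exists_coneHom_eq {l : Λ} (hl : ∀ j, 0 ≤ β.repr l j) : ∃ α, coneHom β α = l := by
  refine ⟨(β.repr l).mapRange Int.toNat rfl, β.repr.injective ?_⟩
  ext j
  rw [repr_coneHom]
  simp [hl j]

theorem coneHom_single (j : J) : coneHom β (Finsupp.single j 1) = β j := by
  apply β.repr.injective
  ext k
  rw [repr_coneHom]
  classical
  simp [Finsupp.single_apply]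

/-- Polynomials in the generators of the cone, as Laurent polynomials. -/
noncomputable def conePoly : MvPolynomial J ℂ →ₐ[ℂ] AddMonoidAlgebra ℂ Λ :=
  AddMonoidAlgebra.mapDomainAlgHom ℂ ℂ (coneHom β)

theorem conePoly_monomial (α : J →₀ ℕ) (c : ℂ) :
    conePoly β (MvPolynomial.monomial α c) = AddMonoidAlgebra.single (coneHom β α) c :=
  AddMonoidAlgebra.mapDomain_single

theorem conePoly_injective : Function.Injective (conePoly β) :=
  AddMonoidAlgebra.mapDomain_injective (coneHom_injective β)

/-- The series supported in the translate by `ν` of the cone, in degrees at least `k`. -/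
def coneSeries (ν : Λ) (k : ℕ) : Submodule ℂ (Λ → ℂ) where
  carrier := {F | ∀ μ, F μ ≠ 0 → ∃ α, μ = ν + coneHom β α ∧ k ≤ α.degree}
  zero_mem' := fun μ h => absurd rfl h
  add_mem' := fun {F G} hF hG μ h => by
    by_cases h0 : F μ = 0
    · exact hG μ (by simpa [h0] using h)
    · exact hF μ h0
  smul_mem' := fun c F hF μ h => hF μ (by
    intro h0
    simp [h0] at h)

theorem coneSeries_anti (ν : Λ) {k l : ℕ} (h : k ≤ l) : coneSeries β ν l ≤ coneSeries β ν k :=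
  fun _ hF μ hμ => (hF μ hμ).imp fun _ h' => ⟨h'.1, h.trans h'.2⟩

theorem coneSeries_apply_eq_zero {ν : Λ} {k : ℕ} {F : Λ → ℂ} (hF : F ∈ coneSeries β ν k)
    {α : J →₀ ℕ} (h : α.degree < k) : F (ν + coneHom β α) = 0 := by
  by_contra h0
  obtain ⟨α', h1, h2⟩ := hF _ h0
  have := coneHom_injective β (add_left_cancel h1)
  subst this
  omega

/-- The power series of a function supported in the translate of the cone by `ν`. -/
noncomputable def coneSer (ν : Λ) : (Λ → ℂ) →ₗ[ℂ] MvPowerSeries J ℂ where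
  toFun F := fun α => F (ν + coneHom β α)
  map_add' _ _ := rfl
  map_smul' _ _ := rfl

theorem coeff_coneSer (ν : Λ) (F : Λ → ℂ) (α : J →₀ ℕ) :
    MvPowerSeries.coeff α (coneSer β ν F) = F (ν + coneHom β α) := rfl

/-- `coneSer` forgets all values off the translated cone, hence the support hypotheses. Identities
between series can then be checked in the domain of power series. -/
theorem coneSer_injOn {ν : Λ} {F G : Λ → ℂ} (hF : F ∈ coneSeries β ν 0)
    (hG : G ∈ coneSeries β ν 0) (h : coneSer β ν F = coneSer β ν G) : F = G := by
  ext μ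
  by_contra hne
  have : (F - G) μ ≠ 0 := sub_ne_zero.2 hne
  obtain ⟨α, rfl, -⟩ := (sub_mem hF hG) μ this
  exact hne (congrFun h α)

/-- The coordinatewise minimum of `ν` and `ν'` serves as `τ`. -/
theorem exists_le_translate [Finite J] (ν ν' : Λ) :
    ∃ τ, (∃ α, ν = τ + coneHom β α) ∧ ∃ α, ν' = τ + coneHom β α := by
  have key : ∀ l : Λ, (∀ j, β.repr (β.repr.symm ((β.repr ν).zipWith (min · ·) (by simp)
      (β.repr ν'))) j ≤ β.repr l j) → ∃ α, l = β.repr.symm ((β.repr ν).zipWith (min · ·) (by simp)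
      (β.repr ν')) + coneHom β α := by
    intro l hl
    obtain ⟨α, hα⟩ := exists_coneHom_eq β (l := l - β.repr.symm ((β.repr ν).zipWith (min · ·)
      (by simp) (β.repr ν'))) fun j => by
        rw [map_sub, Finsupp.sub_apply]
        exact sub_nonneg.2 (hl j)
    exact ⟨α, by rw [hα]; abel⟩
  exact ⟨_, key ν fun j => by simp, key ν' fun j => by simp⟩

theorem coneSeries_translate {ν τ : Λ} {α : J →₀ ℕ} (h : ν = τ + coneHom β α) (k : ℕ) :
    coneSeries β ν k ≤ coneSeries β τ k := fun F hF μ hμ => by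
  obtain ⟨α', h1, h2⟩ := hF μ hμ
  refine ⟨α + α', by rw [h1, h, map_add, add_assoc], ?_⟩
  rw [map_add]
  omega

end Cone

/-! ## Laurent polynomials acting on series -/

section Laurent

variable {Λ : Type*} [AddCommGroup Λ]

theorem mulSeries_eq_sum (b : AddMonoidAlgebra ℂ Λ) (F : Λ → ℂ) (μ : Λ) :
    mulSeries b F μ = b.coeff.sum fun ν c => c * F (μ - ν) := rfl

theorem mulSeries_add (b b' : AddMonoidAlgebra ℂ Λ) (F : Λ → ℂ) :
    mulSeries (b + b') F = mulSeries b F + mulSeries b' F := by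
  ext μ
  simp only [mulSeries_eq_sum, Pi.add_apply, AddMonoidAlgebra.coeff_add]
  exact Finsupp.sum_add_index' (by simp) (by simp [add_mul])

theorem mulSeries_single (ν : Λ) (c : ℂ) (F : Λ → ℂ) (μ : Λ) :
    mulSeries (AddMonoidAlgebra.single ν c) F μ = c * F (μ - ν) := by
  rw [mulSeries_eq_sum, AddMonoidAlgebra.coeff_single]
  exact Finsupp.sum_single_index (by simp)

theorem mulSeries_add_right (b : AddMonoidAlgebra ℂ Λ) (F G : Λ → ℂ) :
    mulSeries b (F + G) = mulSeries b F + mulSeries b G := by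
  ext μ
  simp [mulSeries, mul_add, Finset.sum_add_distrib]

theorem mulSeries_zero_right (b : AddMonoidAlgebra ℂ Λ) : mulSeries b (0 : Λ → ℂ) = 0 := by
  ext μ
  simp [mulSeries]

theorem mulSeries_zero (F : Λ → ℂ) : mulSeries 0 F = 0 := by
  ext μ
  simp [mulSeries]

theorem mulSeries_toSeries (b x : AddMonoidAlgebra ℂ Λ) :
    mulSeries b (toSeries x) = toSeries (b * x) := by
  induction b using AddMonoidAlgebra.induction_linear with
  | zero => rw [mulSeries_zero, zero_mul]; rfl
  | add b b' h h' => rw [mulSeries_add, h, h', add_mul]; rfl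
  | single ν c =>
    ext μ
    rw [mulSeries_single]
    simp [toSeries, sub_eq_neg_add]

theorem toSeries_injective : Function.Injective (toSeries (Λ := Λ)) := fun x y h => by
  ext μ
  exact congrFun h μ

theorem zpoly_mul_zpoly (μ ν : Λ) : zpoly μ * zpoly ν = zpoly (μ + ν) := by
  simp [zpoly, AddMonoidAlgebra.single_mul_single]

theorem zpoly_ne_zero (μ : Λ) : zpoly μ ≠ 0 := by
  simp [zpoly]

theorem zpoly_zero : zpoly (0 : Λ) = 1 := rfl

variable {J : Type*} (β : Module.Basis J ℤ Λ)

/-- The bridge to commutative algebra: after the shifts, a Laurent polynomial acts on series by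
multiplication in the power series ring. -/
theorem mulSeries_conePoly (ν ν' : Λ) (B : MvPolynomial J ℂ) {F : Λ → ℂ}
    (hF : F ∈ coneSeries β ν 0) :
    coneSer β (ν' + ν) (mulSeries (zpoly ν' * conePoly β B) F) = B * coneSer β ν F := by
  induction B using MvPolynomial.induction_on' with
  | add p q hp hq =>
    rw [map_add, mul_add, mulSeries_add, map_add, hp, hq, MvPolynomial.coe_add, add_mul]
  | monomial α c =>
    rw [conePoly_monomial, zpoly, AddMonoidAlgebra.single_mul_single, one_mul]
    ext γ
    classical
    rw [coeff_coneSer, mulSeries_single, MvPolynomial.coe_monomial,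
      MvPowerSeries.coeff_monomial_mul]
    split_ifs with h
    · rw [coeff_coneSer]
      congr 2
      obtain ⟨δ, rfl⟩ := le_iff_exists_add.1 h
      rw [add_tsub_cancel_left, map_add]
      abel
    -- If `α ≰ γ`, the shifted argument lies outside the cone at `ν`, where `F` vanishes.
    · rw [mul_eq_zero]
      right
      by_contra h0
      obtain ⟨δ, h1, -⟩ := hF _ h0
      refine h (le_iff_exists_add.2 ⟨δ, coneHom_injective β ?_⟩)
      rw [map_add]
      have : coneHom β γ = (ν' + ν + coneHom β γ - (ν' + coneHom β α)) - ν + coneHom β α := by abel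
      rw [this, h1]
      abel

theorem mulSeries_mem_coneSeries (ν ν' : Λ) {k : ℕ} {b : AddMonoidAlgebra ℂ Λ} {F : Λ → ℂ}
    (hb : toSeries b ∈ coneSeries β ν' 0) (hF : F ∈ coneSeries β ν k) :
    mulSeries b F ∈ coneSeries β (ν' + ν) k := by
  intro μ hμ
  obtain ⟨l, hl, h⟩ := Finset.exists_ne_zero_of_sum_ne_zero hμ
  obtain ⟨α, h1, -⟩ := hb l (left_ne_zero_of_mul h)
  obtain ⟨α', h2, h3⟩ := hF _ (right_ne_zero_of_mul h)
  refine ⟨α + α', ?_, by rw [map_add]; omega⟩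
  rw [map_add, ← sub_add_cancel μ l, h2, h1]
  abel

theorem coneSer_toSeries_conePoly (ν : Λ) (B : MvPolynomial J ℂ) :
    coneSer β ν (toSeries (zpoly ν * conePoly β B)) = B := by
  have h1 : toSeries (1 : AddMonoidAlgebra ℂ Λ) ∈ coneSeries β 0 0 := by
    intro μ hμ
    refine ⟨0, ?_, le_rfl⟩
    by_contra h
    classical
    refine hμ ?_
    change Finsupp.single (0 : Λ) (1 : ℂ) μ = 0
    rw [Finsupp.single_apply, if_neg]
    simpa [eq_comm] using h
  have h2 : coneSer β 0 (toSeries (1 : AddMonoidAlgebra ℂ Λ)) = 1 := by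
    ext α
    classical
    rw [coeff_coneSer, MvPowerSeries.coeff_one]
    change Finsupp.single (0 : Λ) (1 : ℂ) _ = _
    rw [Finsupp.single_apply, zero_add]
    refine if_congr ?_ rfl rfl
    rw [eq_comm, ← map_zero (coneHom β), (coneHom_injective β).eq_iff]
  have := mulSeries_conePoly β 0 ν B h1
  rwa [mulSeries_toSeries, mul_one, h2, mul_one, add_zero] at this

theorem toSeries_conePoly_mem (ν : Λ) (B : MvPolynomial J ℂ) :
    toSeries (zpoly ν * conePoly β B) ∈ coneSeries β ν 0 := by
  induction B using MvPolynomial.induction_on' with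
  | add p q hp hq =>
    rw [map_add, mul_add]
    exact add_mem hp hq
  | monomial α c =>
    rw [conePoly_monomial, zpoly, AddMonoidAlgebra.single_mul_single, one_mul]
    intro μ hμ
    refine ⟨α, ?_, Nat.zero_le _⟩
    by_contra h
    classical
    exact hμ ((Finsupp.single_apply ..).trans (if_neg (Ne.symm h)))

theorem exists_conePoly {ν : Λ} {b : AddMonoidAlgebra ℂ Λ}
    (hb : toSeries b ∈ coneSeries β ν 0) : ∃ B, b = zpoly ν * conePoly β B := by
  have hinj : Function.Injective fun α => ν + coneHom β α :=
    (add_right_injective ν).comp (coneHom_injective β)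
  let B : MvPolynomial J ℂ := AddMonoidAlgebra.ofCoeff (b.coeff.comapDomain _ hinj.injOn)
  refine ⟨B, toSeries_injective (coneSer_injOn β hb (toSeries_conePoly_mem β ν B) ?_)⟩
  rw [coneSer_toSeries_conePoly]
  ext α
  rfl

theorem exists_toSeries_mem [Finite J] (b : AddMonoidAlgebra ℂ Λ) :
    ∃ ν, toSeries b ∈ coneSeries β ν 0 := by
  induction b using AddMonoidAlgebra.induction_linear with
  | zero => exact ⟨0, zero_mem _⟩
  | add b b' h h' =>
    obtain ⟨ν, h⟩ := h
    obtain ⟨ν', h'⟩ := h'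
    obtain ⟨τ, ⟨α, hα⟩, ⟨α', hα'⟩⟩ := exists_le_translate β ν ν'
    exact ⟨τ, add_mem (coneSeries_translate β hα 0 h) (coneSeries_translate β hα' 0 h')⟩
  | single ν c =>
    refine ⟨ν, fun μ hμ => ⟨0, ?_, le_rfl⟩⟩
    by_contra h
    classical
    refine hμ ((Finsupp.single_apply ..).trans (if_neg fun h' => h ?_))
    rw [map_zero, add_zero, h']

/-- This makes the group algebra of `Λ` a domain, so that `LatticeField Λ` is a field. -/
theorem Module.Basis.uniqueSums (β : Module.Basis J ℤ Λ) : UniqueSums Λ :=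
  UniqueSums.of_injective_addHom (β.repr : Λ →+ (J →₀ ℤ)).toAddHom β.repr.injective inferInstance

end Laurent

/-! ## Regularity of the denominator of an expansion -/

section NormalForm

/-- A polynomial that divides another one as power series divides a multiple of it by
a polynomial with constant term one. -/
theorem MvPolynomial.exists_mul_eq_of_coe_mul_eq {J K : Type*} [Finite J] [Field K]
    {A B : MvPolynomial J K} {F : MvPowerSeries J K} (h : (B : MvPowerSeries J K) * F = A) :
    ∃ r c : MvPolynomial J K, MvPolynomial.constantCoeff r = 1 ∧ A * r = c * B := by
  let m := MvPolynomial.idealOfVars J K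
  -- `A - B F_k` has order at least `k` for the truncation `F_k` of `F`, so `A ∈ (B) + m ^ k` for
  -- every `k`.
  have hA : (Ideal.Quotient.mk (Ideal.span {B}) A) ∈
      (⨅ i : ℕ, m ^ i • ⊤ : Submodule (MvPolynomial J K) (MvPolynomial J K ⧸ Ideal.span {B})) := by
    rw [Submodule.mem_iInf]
    intro k
    have h1 : A - B * MvPowerSeries.truncTotal k F ∈ m ^ k := by
      rw [MvPolynomial.mem_pow_idealOfVars_iff']
      intro x hx
      have h2 : ((A - B * MvPowerSeries.truncTotal k F : MvPolynomial J K) : MvPowerSeries J K) =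
          B * (F - MvPowerSeries.truncTotal k F) := by
        rw [mul_sub, h, ← MvPolynomial.coe_mul]
        exact map_sub (MvPolynomial.coeToMvPowerSeries.ringHom (R := K)) _ _
      rw [← MvPolynomial.coeff_coe, h2]
      classical
      rw [MvPowerSeries.coeff_mul]
      refine Finset.sum_eq_zero fun y hy => mul_eq_zero_of_right _ ?_
      have hy : y.1 + y.2 = x := Finset.HasAntidiagonal.mem_antidiagonal.1 hy
      have : y.2.degree < k := by
        rw [← hy, map_add] at hx
        omega
      rw [map_sub, MvPolynomial.coeff_coe, MvPowerSeries.coeff_truncTotal _ this, sub_self]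
    have h2 : Ideal.Quotient.mk (Ideal.span {B}) A =
        (A - B * MvPowerSeries.truncTotal k F) • Ideal.Quotient.mk (Ideal.span {B}) 1 := by
      rw [← Ideal.Quotient.mk_eq_mk, ← Ideal.Quotient.mk_eq_mk, ← Submodule.Quotient.mk_smul,
        Submodule.Quotient.eq, smul_eq_mul, mul_one, sub_sub_cancel]
      exact Ideal.mul_mem_right _ _ (Ideal.mem_span_singleton_self B)
    rw [h2]
    exact Submodule.smul_mem_smul h1 trivial
  -- Krull's intersection theorem: some `r ∈ m` fixes the class of `A` modulo `B`, so `1 - r` is the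
  -- multiplier sought.
  obtain ⟨⟨r, hr⟩, hrA⟩ := (Ideal.mem_iInf_smul_pow_eq_bot_iff m _).1 hA
  have h3 : B ∣ r * A - A := by
    rw [← Ideal.mem_span_singleton, ← Ideal.Quotient.eq]
    exact hrA
  obtain ⟨c, hc⟩ := h3
  refine ⟨1 - r, -c, ?_, ?_⟩
  · have : MvPolynomial.constantCoeff r = 0 := by
      have := (MvPolynomial.mem_pow_idealOfVars_iff' 1 r).1 (by simpa using hr) 0 (by simp)
      rwa [MvPolynomial.constantCoeff_eq]
    rw [map_sub, this, map_one, sub_zero]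
  · linear_combination -hc

variable {J Λ : Type*} [AddCommGroup Λ] (β : Module.Basis J ℤ Λ)

/-- An expansion of a rational function is the expansion of a fraction whose denominator is a
polynomial on the cone with constant term one. -/
theorem exists_normalForm [Finite J] [UniqueSums Λ] {h : FractionRing (AddMonoidAlgebra ℂ Λ)} {ν : Λ} {F : Λ → ℂ}
    (hF : F ∈ coneSeries β ν 0) {a b : AddMonoidAlgebra ℂ Λ} (hb : b ≠ 0)
    (hh : h * toField b = toField a) (hbF : mulSeries b F = toSeries a) :
    ∃ r c : MvPolynomial J ℂ, MvPolynomial.constantCoeff r = 1 ∧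
      h * toField (conePoly β r) = toField (zpoly ν * conePoly β c) ∧
      (r : MvPowerSeries J ℂ) * coneSer β ν F = c := by
  obtain ⟨ν', hb'⟩ := exists_toSeries_mem β b
  have ha' := mulSeries_mem_coneSeries β ν ν' hb' hF
  rw [hbF] at ha'
  obtain ⟨B, rfl⟩ := exists_conePoly β hb'
  obtain ⟨A, rfl⟩ := exists_conePoly β ha'
  have h1 := mulSeries_conePoly β ν ν' B hF
  rw [hbF, coneSer_toSeries_conePoly] at h1
  obtain ⟨r, c, hr, hrc⟩ := MvPolynomial.exists_mul_eq_of_coe_mul_eq h1.symm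
  have hB : B ≠ 0 := by
    rintro rfl
    simp at hb
  refine ⟨r, c, hr, ?_, ?_⟩
  · have hb' : toField (zpoly ν' * conePoly β B) ≠ 0 :=
      (map_ne_zero_iff _ (IsFractionRing.injective _ _)).2 hb
    apply mul_right_cancel₀ hb'
    rw [mul_right_comm, hh]
    simp only [toField, ← map_mul]
    congr 1
    rw [← zpoly_mul_zpoly]
    have := congrArg (conePoly β) hrc
    rw [map_mul, map_mul] at this
    linear_combination zpoly ν * zpoly ν' * this
  · have hB' : (B : MvPowerSeries J ℂ) ≠ 0 := by simpa using hB
    apply mul_left_cancel₀ hB'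
    have : (A : MvPowerSeries J ℂ) * r = c * B := by exact_mod_cast hrc
    linear_combination this - (r : MvPowerSeries J ℂ) * h1

end NormalForm


/-! ## Pulling back rational functions along a surjection of domains -/

section PullBack

variable {k A A' : Type*} [Field k] [CommRing A] [CommRing A']

/-- The fraction `h` is regular at the generic point of the subscheme defined by the kernel
of `p`, and `h'` is its restriction. -/
def FractionPullsBack (p : A →+* A') (h : FractionRing A) (h' : FractionRing A') : Prop :=
  ∃ a b : A, p b ≠ 0 ∧ h * algebraMap A (FractionRing A) b = algebraMap A (FractionRing A) a ∧
    h' * algebraMap A' (FractionRing A') (p b) = algebraMap A' (FractionRing A') (p a)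

namespace FractionPullsBack

variable {p : A →+* A'} {h h₁ h₂ : FractionRing A} {h' h₁' h₂' : FractionRing A'}

theorem algebraMap_ne_zero {b : A} (hb : b ≠ 0) : algebraMap A (FractionRing A) b ≠ 0 :=
  (map_ne_zero_iff _ (IsFractionRing.injective _ _)).2 hb

theorem ne_zero_of_map_ne_zero {b : A} (hb : p b ≠ 0) : b ≠ 0 := by
  rintro rfl
  exact hb (map_zero p)

theorem neg (H : FractionPullsBack p h h') : FractionPullsBack p (-h) (-h') := by
  obtain ⟨a, b, hb, e, e'⟩ := H
  exact ⟨-a, b, hb, by rw [map_neg, ← e, neg_mul], by rw [map_neg, map_neg, ← e', neg_mul]⟩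

variable [IsDomain A']

/-- Cross-multiplication of two presentations of `h` is an identity in `A`, which `p` carries to
`A'`, where both denominators remain nonzero. -/
theorem unique (H₁ : FractionPullsBack p h h₁') (H₂ : FractionPullsBack p h h₂') : h₁' = h₂' := by
  obtain ⟨a₁, b₁, hb₁, e₁, e₁'⟩ := H₁
  obtain ⟨a₂, b₂, hb₂, e₂, e₂'⟩ := H₂
  have h1 : a₁ * b₂ = a₂ * b₁ := by
    apply IsFractionRing.injective A (FractionRing A)
    rw [map_mul, map_mul, ← e₁, ← e₂]
    ring
  have h2 := congrArg (algebraMap A' (FractionRing A')) (congrArg p h1)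
  simp only [map_mul] at h2
  rw [← e₁', ← e₂'] at h2
  apply mul_right_cancel₀ (mul_ne_zero (algebraMap_ne_zero hb₁) (algebraMap_ne_zero hb₂))
  linear_combination h2

theorem of (p : A →+* A') (a : A) : FractionPullsBack p (algebraMap A (FractionRing A) a)
    (algebraMap A' (FractionRing A') (p a)) :=
  ⟨a, 1, by simp, by simp, by simp⟩

theorem add (H₁ : FractionPullsBack p h₁ h₁') (H₂ : FractionPullsBack p h₂ h₂') :
    FractionPullsBack p (h₁ + h₂) (h₁' + h₂') := by
  obtain ⟨a₁, b₁, hb₁, e₁, e₁'⟩ := H₁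
  obtain ⟨a₂, b₂, hb₂, e₂, e₂'⟩ := H₂
  refine ⟨a₁ * b₂ + a₂ * b₁, b₁ * b₂, ?_, ?_, ?_⟩
  · rw [map_mul]
    exact mul_ne_zero hb₁ hb₂
  · simp only [map_add, map_mul, ← e₁, ← e₂]
    ring
  · simp only [map_add, map_mul, ← e₁', ← e₂']
    ring

theorem mul (H₁ : FractionPullsBack p h₁ h₁') (H₂ : FractionPullsBack p h₂ h₂') :
    FractionPullsBack p (h₁ * h₂) (h₁' * h₂') := by
  obtain ⟨a₁, b₁, hb₁, e₁, e₁'⟩ := H₁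
  obtain ⟨a₂, b₂, hb₂, e₂, e₂'⟩ := H₂
  refine ⟨a₁ * a₂, b₁ * b₂, ?_, ?_, ?_⟩
  · rw [map_mul]
    exact mul_ne_zero hb₁ hb₂
  · simp only [map_mul, ← e₁, ← e₂]
    ring
  · simp only [map_mul, ← e₁', ← e₂']
    ring

variable [IsDomain A]

/-- A nonzero restriction means that the numerator is also outside the kernel: `h` is a unit of the
local ring. -/
theorem inv (H : FractionPullsBack p h h') (hh' : h' ≠ 0) : FractionPullsBack p h⁻¹ h'⁻¹ := by
  obtain ⟨a, b, hb, e, e'⟩ := H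
  have ha : p a ≠ 0 := by
    intro ha
    rw [ha, map_zero] at e'
    exact mul_ne_zero hh' (algebraMap_ne_zero hb) e'
  have hh : h ≠ 0 := by
    rintro rfl
    rw [zero_mul] at e
    exact algebraMap_ne_zero (ne_zero_of_map_ne_zero ha) e.symm
  refine ⟨b, a, ha, ?_, ?_⟩
  · rw [← e, inv_mul_cancel_left₀ hh]
  · rw [← e', inv_mul_cancel_left₀ hh']

/-- Surjectivity of `p` makes `FractionRing A'` the whole residue field at the generic point. -/
theorem exists_lift (hp : Function.Surjective p) (h' : FractionRing A') :
    ∃ h, FractionPullsBack p h h' := by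
  obtain ⟨a', b', hb', rfl⟩ := IsFractionRing.div_surjective (A := A') h'
  obtain ⟨a, rfl⟩ := hp a'
  obtain ⟨b, rfl⟩ := hp b'
  have hb := nonZeroDivisors.ne_zero hb'
  refine ⟨algebraMap _ _ a / algebraMap _ _ b, a, b, hb, ?_, ?_⟩
  · rw [div_mul_cancel₀ _ (algebraMap_ne_zero (ne_zero_of_map_ne_zero hb))]
  · rw [div_mul_cancel₀ _ (algebraMap_ne_zero hb)]

variable [Algebra k A] {ψ : FractionRing A ≃ₐ[k] FractionRing A}

/-- If the images of the elements of `A` are regular at the generic point, and vanish there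
exactly when the elements do, then the same holds for all regular fractions. -/
theorem exists_map (H : ∀ a : A, ∃ h', FractionPullsBack p (ψ (algebraMap _ _ a)) h' ∧
    (h' = 0 ↔ p a = 0)) (hh : FractionPullsBack p h h') :
    ∃ h'', FractionPullsBack p (ψ h) h'' ∧ (h'' = 0 ↔ h' = 0) := by
  obtain ⟨a, b, hb, e, e'⟩ := hh
  obtain ⟨a', ha, ha'⟩ := H a
  obtain ⟨b', hb₁, hb'⟩ := H b
  have hb0 : b' ≠ 0 := fun h0 => hb (hb'.1 h0)
  refine ⟨a' * b'⁻¹, ?_, ?_⟩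
  · have : ψ h = ψ (algebraMap _ _ a) * (ψ (algebraMap _ _ b))⁻¹ := by
      rw [← e, map_mul, mul_inv_cancel_right₀]
      rw [map_ne_zero_iff _ ψ.injective]
      exact algebraMap_ne_zero (ne_zero_of_map_ne_zero hb)
    rw [this]
    exact ha.mul (hb₁.inv hb0)
  · rw [mul_eq_zero, or_iff_left (inv_ne_zero hb0), ha',
      ← map_eq_zero_iff _ (IsFractionRing.injective A' (FractionRing A')), ← e', mul_eq_zero,
      or_iff_left (algebraMap_ne_zero hb)]

theorem exists_function (hp : Function.Surjective p)
    (H : ∀ a : A, ∃ h', FractionPullsBack p (ψ (algebraMap _ _ a)) h' ∧ (h' = 0 ↔ p a = 0)) :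
    ∃ f : FractionRing A' → FractionRing A',
      ∀ h h', FractionPullsBack p h h' → FractionPullsBack p (ψ h) (f h') := by
  have : ∀ h', ∃ h'', ∀ h, FractionPullsBack p h h' → FractionPullsBack p (ψ h) h'' := by
    intro h'
    obtain ⟨h₀, hh₀⟩ := exists_lift hp h'
    obtain ⟨h'', h1, -⟩ := exists_map H hh₀
    refine ⟨h'', fun h hh => ?_⟩
    -- Independence of the lift: the difference of two lifts restricts to zero, and by `exists_map`
    -- so does its image under `ψ`.
    have h2 := hh.add hh₀.neg
    obtain ⟨z, hz, hz'⟩ := exists_map H h2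
    rw [hz'.2 (add_neg_cancel h')] at hz
    simpa using hz.add h1
  choose f hf using this
  exact ⟨f, fun h h' => hf h' h⟩

/-- An automorphism of the fraction field of `A` that preserves, together with its inverse,
regularity and vanishing at the generic point induces an automorphism of the residue field. -/
theorem exists_algEquiv [Algebra k A'] {p : A →ₐ[k] A'} (hp : Function.Surjective p)
    (H : ∀ a : A, ∃ h', FractionPullsBack (p : A →+* A') (ψ (algebraMap _ _ a)) h' ∧
      (h' = 0 ↔ p a = 0))
    (H' : ∀ a : A, ∃ h', FractionPullsBack (p : A →+* A') (ψ.symm (algebraMap _ _ a)) h' ∧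
      (h' = 0 ↔ p a = 0)) :
    ∃ ψ' : FractionRing A' ≃ₐ[k] FractionRing A', ∀ h h',
      FractionPullsBack (p : A →+* A') h h' → FractionPullsBack (p : A →+* A') (ψ h) (ψ' h') := by
  obtain ⟨f, hf⟩ := exists_function (p := (p : A →+* A')) hp H
  obtain ⟨g, hg⟩ := exists_function (p := (p : A →+* A')) hp H'
  refine ⟨⟨⟨f, g, fun x => ?_, fun x => ?_⟩, fun x y => ?_, fun x y => ?_, fun c => ?_⟩, hf⟩
  · obtain ⟨h, hh⟩ := exists_lift (p := (p : A →+* A')) hp x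
    have := hg _ _ (hf _ _ hh)
    rw [AlgEquiv.symm_apply_apply] at this
    exact this.unique hh
  · obtain ⟨h, hh⟩ := exists_lift (p := (p : A →+* A')) hp x
    have := hf _ _ (hg _ _ hh)
    rw [AlgEquiv.apply_symm_apply] at this
    exact this.unique hh
  · obtain ⟨h, hh⟩ := exists_lift (p := (p : A →+* A')) hp x
    obtain ⟨h₁, hh₁⟩ := exists_lift (p := (p : A →+* A')) hp y
    have := hf _ _ (hh.mul hh₁)
    rw [map_mul] at this
    exact this.unique ((hf _ _ hh).mul (hf _ _ hh₁))
  · obtain ⟨h, hh⟩ := exists_lift (p := (p : A →+* A')) hp x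
    obtain ⟨h₁, hh₁⟩ := exists_lift (p := (p : A →+* A')) hp y
    have := hf _ _ (hh.add hh₁)
    rw [map_add] at this
    exact this.unique ((hf _ _ hh).add (hf _ _ hh₁))
  · have h1 : FractionPullsBack (p : A →+* A') (algebraMap k _ c) (algebraMap k _ c) := by
      have := FractionPullsBack.of (p : A →+* A') (algebraMap k A c)
      rwa [AlgHom.coe_toRingHom, AlgHom.commutes, ← IsScalarTower.algebraMap_apply,
        ← IsScalarTower.algebraMap_apply] at this
    have := hf _ _ h1
    rw [AlgEquiv.commutes] at this
    exact this.unique h1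

end FractionPullsBack

end PullBack

/-! ## Pushing series forward along a map of lattices -/

section PushSeries

variable {J J' Λ Λ' : Type*} [AddCommGroup Λ] [AddCommGroup Λ']

/-- The series `∑ F(μ) z^(φ μ)`. -/
noncomputable def pushSeries (φ : Λ →+ Λ') (F : Λ → ℂ) : Λ' → ℂ :=
  fun x => ∑ᶠ μ : {μ : Λ // φ μ = x}, F μ

theorem pushSeries_eq_sum (φ : Λ →+ Λ') (F : Λ → ℂ) (x : Λ') (s : Finset Λ)
    (hs : ∀ μ, φ μ = x → F μ ≠ 0 → μ ∈ s) [DecidableEq Λ'] :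
    pushSeries φ F x = ∑ μ ∈ s with φ μ = x, F μ := by
  rw [pushSeries, finsum_subtype_eq_finsum_cond]
  refine finsum_mem_eq_sum_of_inter_support_eq (s := {μ | φ μ = x}) F ?_
  ext μ
  simp only [Set.mem_inter_iff, Function.mem_support, Finset.coe_filter, Set.mem_ofPred_eq]
  constructor
  · rintro ⟨h1, h2⟩
    exact ⟨⟨hs μ h1 h2, h1⟩, h2⟩
  · rintro ⟨⟨-, h1⟩, h2⟩
    exact ⟨h1, h2⟩

/-- Finite fibres are essential: a `finsum` with infinite support takes the default value zero,
which is not additive. -/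
theorem pushSeries_add (φ : Λ →+ Λ') {F G : Λ → ℂ} (hF : ∀ x, {μ | φ μ = x ∧ F μ ≠ 0}.Finite)
    (hG : ∀ x, {μ | φ μ = x ∧ G μ ≠ 0}.Finite) :
    pushSeries φ (F + G) = pushSeries φ F + pushSeries φ G := by
  classical
  ext x
  have key : ∀ K : Λ → ℂ, (∀ μ, φ μ = x → K μ ≠ 0 → F μ ≠ 0 ∨ G μ ≠ 0) →
      ∀ μ, φ μ = x → K μ ≠ 0 → μ ∈ (hF x).toFinset ∪ (hG x).toFinset := by
    intro K hK μ h1 h2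
    simpa [h1] using hK μ h1 h2
  rw [Pi.add_apply, pushSeries_eq_sum φ (F + G) x _ (key _ ?_), pushSeries_eq_sum φ F x _ (key _ ?_),
    pushSeries_eq_sum φ G x _ (key _ ?_), ← Finset.sum_add_distrib]
  · rfl
  · exact fun μ _ h => Or.inr h
  · exact fun μ _ h => Or.inl h
  · intro μ _ h
    by_contra! h0
    exact h (by rw [Pi.add_apply, h0.1, h0.2, add_zero])

theorem pushSeries_zero (φ : Λ →+ Λ') : pushSeries φ (0 : Λ → ℂ) = 0 := by
  ext x
  exact finsum_zero

/-- Subtracting `ν` identifies the fibre over `x` with that over `x - φ ν`, so no finiteness is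
required. -/
theorem pushSeries_mulSeries_single (φ : Λ →+ Λ') (ν : Λ) (c : ℂ) (F : Λ → ℂ) :
    pushSeries φ (mulSeries (AddMonoidAlgebra.single ν c) F) =
      mulSeries (AddMonoidAlgebra.single (φ ν) c) (pushSeries φ F) := by
  ext x
  rw [mulSeries_single, pushSeries, pushSeries, mul_finsum]
  let E : {μ : Λ // φ μ = x} ≃ {μ : Λ // φ μ = x - φ ν} :=
    (Equiv.subRight ν).subtypeEquiv fun μ => by simp
  rw [← finsum_comp_equiv E]
  refine finsum_congr fun μ => ?_
  rw [mulSeries_single]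
  rfl

theorem mapDomainRingHom_single (φ : Λ →+ Λ') (ν : Λ) (c : ℂ) :
    AddMonoidAlgebra.mapDomainRingHom ℂ φ (AddMonoidAlgebra.single ν c) =
      AddMonoidAlgebra.single (φ ν) c :=
  AddMonoidAlgebra.mapDomain_single

theorem pushSeries_toSeries (φ : Λ →+ Λ') (x : AddMonoidAlgebra ℂ Λ) :
    pushSeries φ (toSeries x) = toSeries (AddMonoidAlgebra.mapDomainRingHom ℂ φ x) := by
  have hfin : ∀ (x : AddMonoidAlgebra ℂ Λ) y, {μ | φ μ = y ∧ toSeries x μ ≠ 0}.Finite :=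
    fun x y => x.coeff.support.finite_toSet.subset fun μ h => Finsupp.mem_support_iff.2 h.2
  induction x using AddMonoidAlgebra.induction_linear with
  | zero => rw [map_zero]; exact pushSeries_zero φ
  | add x y hx hy =>
    rw [map_add]
    change pushSeries φ (toSeries x + toSeries y) = _
    rw [pushSeries_add φ (hfin x) (hfin y), hx, hy]
    rfl
  | single ν c =>
    classical
    ext y
    rw [pushSeries_eq_sum φ _ y {ν}]
    · rw [Finset.sum_filter, Finset.sum_singleton, mapDomainRingHom_single]
      simp [toSeries, Finsupp.single_apply]
    · intro μ _ h
      rw [Finset.mem_singleton]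
      by_contra h0
      exact h (by simp [toSeries, Ne.symm h0])

variable (β : Module.Basis J ℤ Λ) (β' : Module.Basis J' ℤ Λ') {φ : Λ →+ Λ'} {o : J → J'}

theorem map_coneHom (hφ : ∀ j, φ (β j) = β' (o j)) (α : J →₀ ℕ) :
    φ (coneHom β α) = coneHom β' (α.mapDomain o) := by
  induction α using Finsupp.induction_linear with
  | zero => simp
  | add α α' h h' => rw [map_add, map_add, h, h', Finsupp.mapDomain_add, map_add]
  | single j n =>
    have h1 : Finsupp.single j n = n • Finsupp.single j 1 := by simp
    have h2 : Finsupp.single (o j) n = n • Finsupp.single (o j) 1 := by simp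
    rw [Finsupp.mapDomain_single, h1, h2, map_nsmul, map_nsmul, map_nsmul, coneHom_single,
      coneHom_single, hφ]

theorem mapDomain_conePoly (hφ : ∀ j, φ (β j) = β' (o j)) (r : MvPolynomial J ℂ) :
    AddMonoidAlgebra.mapDomainRingHom ℂ φ (conePoly β r) =
      conePoly β' (MvPolynomial.rename o r) := by
  induction r using MvPolynomial.induction_on' with
  | add p q hp hq => simp only [map_add, hp, hq]
  | monomial α c =>
    rw [MvPolynomial.rename_monomial, conePoly_monomial, conePoly_monomial,
      mapDomainRingHom_single, map_coneHom β β' hφ]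

theorem map_surjective (hφ : ∀ j, φ (β j) = β' (o j)) (ho : Function.Surjective o) :
    Function.Surjective φ := by
  rw [← AddMonoidHom.coe_toIntLinearMap, ← LinearMap.range_eq_top, eq_top_iff, ← β'.span_eq,
    Submodule.span_le]
  rintro _ ⟨j', rfl⟩
  obtain ⟨j, rfl⟩ := ho j'
  exact ⟨β j, hφ j⟩

theorem mapDomainRingHom_surjective (hφ : Function.Surjective φ) :
    Function.Surjective (AddMonoidAlgebra.mapDomainRingHom ℂ φ) := by
  intro x
  induction x using AddMonoidAlgebra.induction_linear with
  | zero => exact ⟨0, map_zero _⟩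
  | add x y hx hy =>
    obtain ⟨a, rfl⟩ := hx
    obtain ⟨b, rfl⟩ := hy
    exact ⟨a + b, map_add _ _ _⟩
  | single ν c =>
    obtain ⟨μ, rfl⟩ := hφ ν
    exact ⟨AddMonoidAlgebra.single μ c, mapDomainRingHom_single ..⟩

theorem degree_mapDomain (f : J → J') (α : J →₀ ℕ) : (α.mapDomain f).degree = α.degree := by
  induction α using Finsupp.induction_linear with
  | zero => simp
  | add α α' h h' => rw [Finsupp.mapDomain_add, map_add, map_add, h, h']
  | single j n => simp

theorem pushSeries_mem_coneSeries (hφ : ∀ j, φ (β j) = β' (o j)) {ν : Λ} {k : ℕ} {F : Λ → ℂ}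
    (hF : F ∈ coneSeries β ν k) : pushSeries φ F ∈ coneSeries β' (φ ν) k := by
  intro x hx
  obtain ⟨⟨μ, rfl⟩, h⟩ : ∃ μ : {μ : Λ // φ μ = x}, F μ ≠ 0 := by
    by_contra! h
    exact hx (finsum_eq_zero_of_forall_eq_zero h)
  obtain ⟨α, h1, h2⟩ := hF μ h
  exact ⟨α.mapDomain o, by rw [h1, map_add, map_coneHom β β' hφ], by rwa [degree_mapDomain]⟩

variable [Finite J]

/-- `φ` preserves degrees on the cone, and only finitely many exponents have bounded degree. All
later exchanges of sums rest on this. -/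
theorem finite_fiber_coneSeries (hφ : ∀ j, φ (β j) = β' (o j)) {ν : Λ} {F : Λ → ℂ}
    (hF : F ∈ coneSeries β ν 0) (x : Λ') : {μ | φ μ = x ∧ F μ ≠ 0}.Finite := by
  by_cases hx : ∃ γ, x = φ ν + coneHom β' γ
  · obtain ⟨γ, rfl⟩ := hx
    refine ((Finsupp.finite_of_degree_le γ.degree).image fun α => ν + coneHom β α).subset ?_
    rintro μ ⟨h1, h2⟩
    obtain ⟨α, rfl, -⟩ := hF μ h2
    refine ⟨α, ?_, rfl⟩
    rw [map_add, map_coneHom β β' hφ] at h1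
    have := coneHom_injective β' (add_left_cancel h1)
    rw [Set.mem_ofPred_eq, ← this, degree_mapDomain]
  · convert Set.finite_empty
    rw [Set.eq_empty_iff_forall_notMem]
    rintro μ ⟨rfl, h2⟩
    obtain ⟨α, rfl, -⟩ := hF μ h2
    exact hx ⟨α.mapDomain o, by rw [map_add, map_coneHom β β' hφ]⟩

theorem pushSeries_mulSeries (hφ : ∀ j, φ (β j) = β' (o j)) (b : AddMonoidAlgebra ℂ Λ) {ν : Λ}
    {F : Λ → ℂ} (hF : F ∈ coneSeries β ν 0) :
    pushSeries φ (mulSeries b F) =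
      mulSeries (AddMonoidAlgebra.mapDomainRingHom ℂ φ b) (pushSeries φ F) := by
  induction b using AddMonoidAlgebra.induction_linear with
  | zero => rw [mulSeries_zero, map_zero, mulSeries_zero, pushSeries_zero]
  | add x y hx hy =>
    obtain ⟨ν₁, h₁⟩ := exists_toSeries_mem β x
    obtain ⟨ν₂, h₂⟩ := exists_toSeries_mem β y
    rw [mulSeries_add, map_add, mulSeries_add, pushSeries_add φ, hx, hy]
    · exact finite_fiber_coneSeries β β' hφ (mulSeries_mem_coneSeries β ν ν₁ h₁ hF)
    · exact finite_fiber_coneSeries β β' hφ (mulSeries_mem_coneSeries β ν ν₂ h₂ hF)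
  | single μ c =>
    rw [mapDomainRingHom_single, pushSeries_mulSeries_single]

/-- The rational function `h` has the formal series `F` as its expansion. -/
def IsConeExpansion (h : LatticeField Λ) (F : Λ → ℂ) : Prop :=
  (∃ ν, F ∈ coneSeries β ν 0) ∧ ∃ a b : AddMonoidAlgebra ℂ Λ,
    b ≠ 0 ∧ h * toField b = toField a ∧ mulSeries b F = toSeries a

-- In the normal form `r F = c` with `r(0) = 1`, a zero fraction forces `c = 0`, and `r` cancels in
-- the power series ring. Vanishing of a restriction can thus be read off its series.
variable {β} in
theorem IsConeExpansion.eq_zero_iff [UniqueSums Λ] {h : LatticeField Λ} {F : Λ → ℂ}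
    (H : IsConeExpansion β h F) : h = 0 ↔ F = 0 := by
  obtain ⟨⟨ν, hF⟩, a, b, hb, e, e'⟩ := H
  constructor
  · rintro rfl
    obtain ⟨r, c, hr, h1, h2⟩ := exists_normalForm β hF hb e e'
    rw [zero_mul, eq_comm, toField, map_eq_zero_iff _ (IsFractionRing.injective _ _),
      mul_eq_zero, or_iff_right (zpoly_ne_zero ν),
      map_eq_zero_iff _ (conePoly_injective β)] at h1
    have hr0 : (r : MvPowerSeries J ℂ) ≠ 0 := by
      rw [Ne, MvPolynomial.coe_eq_zero_iff]
      rintro rfl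
      simp at hr
    rw [h1, MvPolynomial.coe_zero, mul_eq_zero, or_iff_right hr0] at h2
    exact coneSer_injOn β hF (zero_mem _) (by rw [h2, map_zero])
  · rintro rfl
    rw [mulSeries_zero_right] at e'
    have : a = 0 := toSeries_injective e'.symm
    rw [this, toField, toField, map_zero, mul_eq_zero, or_iff_left
      (FractionPullsBack.algebraMap_ne_zero hb)] at e
    exact e

variable {β} in
/-- A rational function with an expansion is regular at the generic point of a subtorus on
which the cone stays strictly convex, and the expansion restricts to the subtorus. -/
theorem IsConeExpansion.exists_pullsBack [UniqueSums Λ] [UniqueSums Λ']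
    (hφ : ∀ j, φ (β j) = β' (o j)) {h : LatticeField Λ} {F : Λ → ℂ}
    (H : IsConeExpansion β h F) :
    ∃ h', FractionPullsBack (AddMonoidAlgebra.mapDomainRingHom ℂ φ) h h' ∧
      IsConeExpansion β' h' (pushSeries φ F) := by
  obtain ⟨⟨ν, hF⟩, a, b, hb, e, e'⟩ := H
  obtain ⟨r, c, hr, h1, h2⟩ := exists_normalForm β hF hb e e'
  -- Identifying variables keeps the constant term `1`, so the denominator does not vanish on the
  -- subtorus.
  have hr' : AddMonoidAlgebra.mapDomainRingHom ℂ φ (conePoly β r) ≠ 0 := by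
    rw [mapDomain_conePoly β β' hφ, Ne, map_eq_zero_iff _ (conePoly_injective β')]
    intro h0
    have := congrArg MvPolynomial.constantCoeff h0
    rw [MvPolynomial.constantCoeff_rename, hr, map_zero] at this
    exact one_ne_zero this
  have h3 : mulSeries (conePoly β r) F = toSeries (zpoly ν * conePoly β c) := by
    have hz : zpoly (0 : Λ) * conePoly β r = conePoly β r := by rw [zpoly_zero, one_mul]
    refine coneSer_injOn β ?_ (toSeries_conePoly_mem β ν c) ?_
    · have := mulSeries_mem_coneSeries β ν 0 (toSeries_conePoly_mem β 0 r) hF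
      rwa [hz, zero_add] at this
    · have := mulSeries_conePoly β ν 0 r hF
      rw [hz, zero_add] at this
      rw [this, h2, coneSer_toSeries_conePoly]
  refine ⟨toField (AddMonoidAlgebra.mapDomainRingHom ℂ φ (zpoly ν * conePoly β c)) /
    toField (AddMonoidAlgebra.mapDomainRingHom ℂ φ (conePoly β r)), ?_, ?_⟩
  · refine ⟨_, _, hr', h1, ?_⟩
    exact div_mul_cancel₀ _ (FractionPullsBack.algebraMap_ne_zero hr')
  · refine ⟨⟨φ ν, pushSeries_mem_coneSeries β β' hφ hF⟩, _, _, hr',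
      div_mul_cancel₀ _ (FractionPullsBack.algebraMap_ne_zero hr'), ?_⟩
    rw [← pushSeries_mulSeries β β' hφ _ hF, h3, pushSeries_toSeries]

end PushSeries

/-! ## Unipotent operators on series -/

section Unipotent

variable {J Λ : Type*} [AddCommGroup Λ] (β : Module.Basis J ℤ Λ)

theorem eq_zero_of_forall_mem_coneSeries {ν : Λ} {F : Λ → ℂ} (hF : ∀ k, F ∈ coneSeries β ν k) :
    F = 0 := by
  ext μ
  by_contra h
  obtain ⟨α, rfl, -⟩ := hF 0 μ h
  exact h (coneSeries_apply_eq_zero β (hF (α.degree + 1)) (Nat.lt_succ_self _))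

/-- Completeness for the degree filtration: the coefficient at `α` no longer changes from `w
(α.degree + 1)` on, and this is its limit. -/
theorem exists_limit_coneSeries {ν : Λ} {w : ℕ → Λ → ℂ} (h0 : w 0 = 0)
    (hw : ∀ k, w (k + 1) - w k ∈ coneSeries β ν k) :
    ∃ W, ∀ k, W - w k ∈ coneSeries β ν k := by
  have hle : ∀ k l, w (k + l) - w k ∈ coneSeries β ν k := by
    intro k l
    induction l with
    | zero => simp
    | succ l ih =>
      have := add_mem ih (coneSeries_anti β ν (Nat.le_add_right k l) (hw (k + l)))
      rwa [add_comm, sub_add_sub_cancel] at this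
  have hzero : ∀ k, w k ∈ coneSeries β ν 0 := fun k => by
    have := hle 0 k
    rwa [h0, sub_zero, zero_add] at this
  classical
  let W : Λ → ℂ := fun μ =>
    if h : ∃ α, μ = ν + coneHom β α then w (h.choose.degree + 1) μ else 0
  have hW : ∀ α, W (ν + coneHom β α) = w (α.degree + 1) (ν + coneHom β α) := by
    intro α
    have h : ∃ α', ν + coneHom β α = ν + coneHom β α' := ⟨α, rfl⟩
    have h1 : h.choose = α := coneHom_injective β (add_left_cancel h.choose_spec.symm)
    simp only [W]
    rw [dif_pos h, h1]
  refine ⟨W, fun k μ hμ => ?_⟩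
  by_cases h : ∃ α, μ = ν + coneHom β α
  · obtain ⟨α, rfl⟩ := h
    refine ⟨α, rfl, ?_⟩
    by_contra! hk
    obtain ⟨l, rfl⟩ := Nat.exists_eq_add_of_lt hk
    have := coneSeries_apply_eq_zero β (hle (α.degree + 1) l) (Nat.lt_succ_self _)
    refine hμ ?_
    rw [Pi.sub_apply, hW, ← neg_eq_zero, neg_sub, ← Pi.sub_apply, add_right_comm]
    exact this
  · exfalso
    refine hμ ?_
    have h1 : W μ = 0 := dif_neg h
    have h2 : w k μ = 0 := by
      by_contra h2
      exact h ((hzero k μ h2).imp fun _ h3 => h3.1)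
    rw [Pi.sub_apply, h1, h2, sub_zero]

/-- `Φ` is additive and differs from the identity by an operator that raises degrees. -/
structure IsUnipotentOn (ν : Λ) (Φ : (Λ → ℂ) → Λ → ℂ) : Prop where
  map_add : ∀ F ∈ coneSeries β ν 0, ∀ G ∈ coneSeries β ν 0, Φ (F + G) = Φ F + Φ G
  sub_self_mem : ∀ k, ∀ F ∈ coneSeries β ν k, Φ F - F ∈ coneSeries β ν (k + 1)

namespace IsUnipotentOn

variable {β} {ν : Λ} {Φ : (Λ → ℂ) → Λ → ℂ}

theorem mem (H : IsUnipotentOn β ν Φ) {k : ℕ} {F : Λ → ℂ} (hF : F ∈ coneSeries β ν k) : Φ F ∈ coneSeries β ν k := by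
  have := add_mem (coneSeries_anti β ν k.le_succ (H.sub_self_mem k F hF)) hF
  rwa [sub_add_cancel] at this

theorem map_sub (H : IsUnipotentOn β ν Φ) {F G : Λ → ℂ} (hF : F ∈ coneSeries β ν 0) (hG : G ∈ coneSeries β ν 0) :
    Φ (F - G) = Φ F - Φ G := by
  have := H.map_add (F - G) (sub_mem hF hG) G hG
  rw [sub_add_cancel] at this
  rw [this, add_sub_cancel_right]

/-- If `Φ D = 0`, then `D = -(Φ D - D)` lies one degree higher than known before, hence in every
degree. -/
theorem injOn (H : IsUnipotentOn β ν Φ) {F G : Λ → ℂ} (hF : F ∈ coneSeries β ν 0) (hG : G ∈ coneSeries β ν 0)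
    (h : Φ F = Φ G) : F = G := by
  rw [← sub_eq_zero]
  have h0 : Φ (F - G) = 0 := by rw [H.map_sub hF hG, h, sub_self]
  refine eq_zero_of_forall_mem_coneSeries β (ν := ν) fun k => ?_
  induction k with
  | zero => exact sub_mem hF hG
  | succ k ih =>
    have := H.sub_self_mem k _ ih
    rwa [h0, zero_sub, neg_mem_iff] at this

/-- Successive approximation: adding the error `r = x - Φ w` to `w` leaves the error `-(Φ r - r)`,
one degree higher. -/
theorem exists_eq (H : IsUnipotentOn β ν Φ) {x : Λ → ℂ} (hx : x ∈ coneSeries β ν 0) :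
    ∃ W ∈ coneSeries β ν 0, Φ W = x := by
  let w : ℕ → Λ → ℂ := fun k => (fun F => F + (x - Φ F))^[k] 0
  have hs : ∀ k, w (k + 1) = w k + (x - Φ (w k)) := fun k =>
    Function.iterate_succ_apply' _ _ _
  have hw : ∀ k, w k ∈ coneSeries β ν 0 ∧ x - Φ (w k) ∈ coneSeries β ν k := by
    intro k
    induction k with
    | zero => exact ⟨zero_mem _, sub_mem hx (H.mem (zero_mem _))⟩
    | succ k ih =>
      have hr := coneSeries_anti β ν (Nat.zero_le k) ih.2
      refine ⟨by rw [hs]; exact add_mem ih.1 hr, ?_⟩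
      have := neg_mem (H.sub_self_mem k _ ih.2)
      rw [hs, H.map_add _ ih.1 _ hr]
      convert this using 1
      abel
  obtain ⟨W, hW⟩ := exists_limit_coneSeries β (ν := ν) (w := w) rfl fun k => by
    rw [hs, add_sub_cancel_left]
    exact (hw k).2
  have hW0 : W ∈ coneSeries β ν 0 := by simpa [w] using hW 0
  refine ⟨W, hW0, ?_⟩
  rw [← sub_eq_zero]
  refine eq_zero_of_forall_mem_coneSeries β (ν := ν) fun k => ?_
  have := sub_mem (H.mem (hW k)) (hw k).2
  rw [H.map_sub hW0 (hw k).1] at this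
  convert this using 1
  abel

end IsUnipotentOn

end Unipotent

/-! ## The action of the pro-unipotent group -/

namespace LatticeDatum

variable {I N M : Type*} [AddCommGroup N] [AddCommGroup M] (T : LatticeDatum I N M)

/-- The shear `(m, n) ↦ (m + {n, ·}, n)` of `M ⊕ N`. -/
def shear : (M × N) ≃ₗ[ℤ] (M × N) where
  toFun x := (x.1 + T.p x.2, x.2)
  invFun x := (x.1 - T.p x.2, x.2)
  map_add' x y := by
    ext
    · simp only [Prod.fst_add, Prod.snd_add, map_add]
      abel
    · rfl
  map_smul' c x := by
    ext
    · simp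
    · rfl
  left_inv x := by simp
  right_inv x := by simp

/-- The basis of `M ⊕ N` that generates the monoid `P`. -/
noncomputable def coneBasis : Module.Basis (I ⊕ I) ℤ (M × N) := (T.f.prod T.e).map T.shear

theorem coneBasis_inl (i : I) : T.coneBasis (Sum.inl i) = (T.f i, 0) := by
  simp [coneBasis, shear]

theorem coneBasis_inr (i : I) : T.coneBasis (Sum.inr i) = (T.p (T.e i), T.e i) := by
  simp [coneBasis, shear]

theorem mem_P_iff {μ : M × N} : μ ∈ T.P ↔ ∃ α, μ = coneHom T.coneBasis α := by
  constructor
  · intro h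
    suffices T.P ≤ AddMonoidHom.mrange (coneHom T.coneBasis) by
      obtain ⟨α, hα⟩ := this h
      exact ⟨α, hα.symm⟩
    refine AddSubmonoid.closure_le.2 ?_
    rintro _ (⟨i, rfl⟩ | ⟨i, rfl⟩)
    · exact ⟨Finsupp.single (Sum.inl i) 1, by rw [coneHom_single, coneBasis_inl]⟩
    · exact ⟨Finsupp.single (Sum.inr i) 1, by rw [coneHom_single, coneBasis_inr]⟩
  · rintro ⟨α, rfl⟩
    induction α using Finsupp.induction_linear with
    | zero => rw [map_zero]; exact zero_mem _
    | add α α' h h' => rw [map_add]; exact add_mem h h'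
    | single j n =>
      have h1 : Finsupp.single j n = n • Finsupp.single j 1 := by simp
      rw [h1, map_nsmul, coneHom_single]
      refine nsmul_mem (AddSubmonoid.subset_closure ?_) n
      obtain i | i := j
      · exact Or.inl ⟨i, (T.coneBasis_inl i).symm⟩
      · exact Or.inr ⟨i, (T.coneBasis_inr i).symm⟩

theorem isLaurent_iff {F : M × N → ℂ} :
    T.IsLaurent F ↔ ∃ ν, F ∈ coneSeries T.coneBasis ν 0 := by
  refine exists_congr fun ν => forall₂_congr fun μ _ => ?_
  rw [mem_P_iff]
  refine exists_congr fun α => ?_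
  rw [sub_eq_iff_eq_add']
  simp

theorem isExpansion_iff {h : LatticeField (M × N)} {F : M × N → ℂ} :
    T.IsExpansion h F ↔ IsConeExpansion T.coneBasis h F :=
  and_congr_left' T.isLaurent_iff

/-- Undoing the shear gives `(0, n)`, so the cone coordinates are those of `n` in the seed. The
positive degree is what makes `ĝ` act nilpotently on each coefficient. -/
theorem exists_coneHom_of_pos (n : T.pos) :
    ∃ γ, (T.p n, (n : N)) = coneHom T.coneBasis γ ∧ 1 ≤ γ.degree := by
  have h1 : T.shear.symm (T.p n, (n : N)) = (0, (n : N)) := by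
    ext
    · exact sub_self _
    · rfl
  obtain ⟨γ, hγ⟩ := exists_coneHom_eq T.coneBasis (l := (T.p n, (n : N))) (by
    intro j
    rw [coneBasis, Module.Basis.map_repr, LinearEquiv.trans_apply, h1]
    obtain i | i := j
    · simp
    · simpa using n.2.2 i)
  refine ⟨γ, hγ.symm, Nat.one_le_iff_ne_zero.2 fun h0 => n.2.1 ?_⟩
  rw [Finsupp.degree_eq_zero_iff] at h0
  rw [h0, map_zero] at hγ
  exact (congrArg Prod.snd hγ).symm

theorem lieAct_apply (f : T.LieHat) (F : M × N → ℂ) (μ : M × N) :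
    T.lieAct f F μ =
      ∑ᶠ n : T.pos, f n * T.pairing n (μ.1 - T.p n) * F (μ - (T.p n, (n : N))) := rfl

theorem lieAct_mem (f : T.LieHat) {ν : M × N} {k : ℕ} {F : M × N → ℂ}
    (hF : F ∈ coneSeries T.coneBasis ν k) : T.lieAct f F ∈ coneSeries T.coneBasis ν (k + 1) := by
  intro μ hμ
  rw [lieAct_apply] at hμ
  obtain ⟨n, hn⟩ : ∃ n : T.pos,
      f n * T.pairing n (μ.1 - T.p n) * F (μ - (T.p n, (n : N))) ≠ 0 := by
    by_contra! h
    exact hμ (finsum_eq_zero_of_forall_eq_zero h)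
  obtain ⟨α, h1, h2⟩ := hF _ (right_ne_zero_of_mul hn)
  obtain ⟨γ, h3, h4⟩ := T.exists_coneHom_of_pos n
  refine ⟨α + γ, ?_, by rw [map_add]; omega⟩
  rw [map_add, ← add_assoc, ← h1, ← h3, sub_add_cancel]

theorem lieAct_iterate_mem (f : T.LieHat) {ν : M × N} {k : ℕ} {F : M × N → ℂ}
    (hF : F ∈ coneSeries T.coneBasis ν k) (j : ℕ) :
    (T.lieAct f)^[j] F ∈ coneSeries T.coneBasis ν (k + j) := by
  induction j with
  | zero => exact hF
  | succ j ih =>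
    rw [Function.iterate_succ_apply']
    exact T.lieAct_mem f ih

/-- `n ↦ μ - (p n, n)` is injective and lands in exponents of degree at most that of `μ`. -/
theorem finite_lieAct_support [Finite I] {ν : M × N} {F : M × N → ℂ}
    (hF : F ∈ coneSeries T.coneBasis ν 0) (μ : M × N) :
    {n : T.pos | F (μ - (T.p n, (n : N))) ≠ 0}.Finite := by
  by_cases hμ : ∃ δ, μ = ν + coneHom T.coneBasis δ
  · obtain ⟨δ, rfl⟩ := hμ
    have hinj : Function.Injective fun n : T.pos =>
        ν + coneHom T.coneBasis δ - (T.p n, (n : N)) := fun n n' h => by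
      have := congrArg Prod.snd (sub_right_injective h)
      exact Subtype.ext this
    refine Set.Finite.of_injOn (f := fun n : T.pos =>
        ν + coneHom T.coneBasis δ - (T.p n, (n : N))) ?_ hinj.injOn
      ((Finsupp.finite_of_degree_le δ.degree).image fun α => ν + coneHom T.coneBasis α)
    intro n hn
    obtain ⟨α, h1, -⟩ := hF _ hn
    obtain ⟨γ, h2, -⟩ := T.exists_coneHom_of_pos n
    refine ⟨α, ?_, h1.symm⟩
    have : coneHom T.coneBasis δ = coneHom T.coneBasis (α + γ) := by
      apply add_left_cancel (a := ν)
      rw [map_add, ← add_assoc, ← h1, ← h2, sub_add_cancel]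
    rw [Set.mem_ofPred_eq, coneHom_injective _ this, map_add]
    exact Nat.le_add_right _ _
  · convert Set.finite_empty
    rw [Set.eq_empty_iff_forall_notMem]
    intro n hn
    obtain ⟨α, h1, -⟩ := hF _ hn
    obtain ⟨γ, h2, -⟩ := T.exists_coneHom_of_pos n
    exact hμ ⟨α + γ, by rw [map_add, ← add_assoc, ← h1, ← h2, sub_add_cancel]⟩

theorem lieAct_add [Finite I] (f : T.LieHat) {ν : M × N} {F G : M × N → ℂ}
    (hF : F ∈ coneSeries T.coneBasis ν 0) (hG : G ∈ coneSeries T.coneBasis ν 0) :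
    T.lieAct f (F + G) = T.lieAct f F + T.lieAct f G := by
  ext μ
  rw [Pi.add_apply, lieAct_apply, lieAct_apply, lieAct_apply, ← finsum_add_distrib]
  · simp only [Pi.add_apply, mul_add]
  · exact (T.finite_lieAct_support hF μ).subset fun n hn => right_ne_zero_of_mul hn
  · exact (T.finite_lieAct_support hG μ).subset fun n hn => right_ne_zero_of_mul hn

theorem lieAct_iterate_add [Finite I] (f : T.LieHat) {ν : M × N} {F G : M × N → ℂ}
    (hF : F ∈ coneSeries T.coneBasis ν 0) (hG : G ∈ coneSeries T.coneBasis ν 0) (k : ℕ) :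
    (T.lieAct f)^[k] (F + G) = (T.lieAct f)^[k] F + (T.lieAct f)^[k] G := by
  induction k with
  | zero => rfl
  | succ k ih =>
    rw [Function.iterate_succ_apply', ih, Function.iterate_succ_apply',
      Function.iterate_succ_apply']
    exact T.lieAct_add f (coneSeries_anti _ _ (Nat.zero_le _) (T.lieAct_iterate_mem f hF k))
      (coneSeries_anti _ _ (Nat.zero_le _) (T.lieAct_iterate_mem f hG k))

/-- The `k`-th iterate starts in degree `k`, so the exponential series stops at each coefficient. -/
theorem act_apply_eq_sum (g : T.ProGroup) {ν : M × N} {F : M × N → ℂ}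
    (hF : F ∈ coneSeries T.coneBasis ν 0) {α : I ⊕ I →₀ ℕ} {n : ℕ} (hn : α.degree < n) :
    T.act g F (ν + coneHom T.coneBasis α) = ∑ k ∈ Finset.range n,
      (k.factorial : ℂ)⁻¹ * (T.lieAct g.log)^[k] F (ν + coneHom T.coneBasis α) := by
  refine finsum_eq_sum_of_support_subset _ fun k hk => ?_
  by_contra h
  rw [Finset.mem_coe, Finset.mem_range, not_lt] at h
  refine right_ne_zero_of_mul hk
    (coneSeries_apply_eq_zero _ (T.lieAct_iterate_mem g.log hF k) ?_)
  omega

theorem act_sub_mem (g : T.ProGroup) {ν : M × N} {k : ℕ} {F : M × N → ℂ}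
    (hF : F ∈ coneSeries T.coneBasis ν k) :
    T.act g F - F ∈ coneSeries T.coneBasis ν (k + 1) := by
  have hF0 := coneSeries_anti _ _ (Nat.zero_le k) hF
  intro μ hμ
  by_cases h : ∃ α, μ = ν + coneHom T.coneBasis α
  · obtain ⟨α, rfl⟩ := h
    refine ⟨α, rfl, ?_⟩
    by_contra! hk
    refine hμ ?_
    rw [Pi.sub_apply, T.act_apply_eq_sum g hF0 (Nat.lt_succ_self _), Finset.sum_range_succ',
      Finset.sum_eq_zero]
    · simp
    · intro j _
      rw [coneSeries_apply_eq_zero _ (T.lieAct_iterate_mem g.log hF (j + 1)) (by omega), mul_zero]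
  · exfalso
    have h0 : ∀ j, (T.lieAct g.log)^[j] F μ = 0 := by
      intro j
      by_contra hj
      obtain ⟨α, h1, -⟩ := T.lieAct_iterate_mem g.log hF j μ hj
      exact h ⟨α, h1⟩
    refine hμ ?_
    rw [Pi.sub_apply, act, finsum_eq_zero_of_forall_eq_zero, zero_sub, neg_eq_zero]
    · exact h0 0
    · intro j
      rw [h0, mul_zero]

theorem finite_act_support (f : T.LieHat) {ν : M × N} {F : M × N → ℂ}
    (hF : F ∈ coneSeries T.coneBasis ν 0) (μ : M × N) :
    {k | (T.lieAct f)^[k] F μ ≠ 0}.Finite := by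
  by_cases h : ∃ α, μ = ν + coneHom T.coneBasis α
  · obtain ⟨α, rfl⟩ := h
    refine (Set.finite_Iic α.degree).subset fun k hk => ?_
    by_contra h
    refine hk (coneSeries_apply_eq_zero _ (T.lieAct_iterate_mem f hF k) ?_)
    rw [Set.mem_Iic] at h
    omega
  · refine Set.finite_empty.subset fun k hk => ?_
    obtain ⟨α, h1, -⟩ := T.lieAct_iterate_mem f hF k μ hk
    exact h ⟨α, h1⟩

theorem act_isUnipotentOn [Finite I] (g : T.ProGroup) (ν : M × N) :
    IsUnipotentOn T.coneBasis ν (T.act g) where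
  sub_self_mem _ _ hF := T.act_sub_mem g hF
  map_add F hF G hG := by
    have key : ∀ K ∈ coneSeries T.coneBasis ν 0, ∀ μ,
        (fun k : ℕ => (k.factorial : ℂ)⁻¹ * (T.lieAct g.log)^[k] K μ).HasFiniteSupport :=
      fun K hK μ => (T.finite_act_support g.log hK μ).subset fun k hk => right_ne_zero_of_mul hk
    ext μ
    rw [Pi.add_apply, act, act, act, ← finsum_add_distrib (key F hF μ) (key G hG μ)]
    refine finsum_congr fun k => ?_
    rw [T.lieAct_iterate_add g.log hF hG, Pi.add_apply, mul_add]

end LatticeDatum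

/-! ## Expansions of products and of inverse images -/

section Product

variable {J Λ : Type*} [AddCommGroup Λ] (β : Module.Basis J ℤ Λ)

theorem isConeExpansion_toSeries [Finite J] (x : AddMonoidAlgebra ℂ Λ) :
    IsConeExpansion β (toField x) (toSeries x) := by
  refine ⟨exists_toSeries_mem β x, x, 1, ?_, ?_, ?_⟩
  · exact one_ne_zero
  · simp [toField]
  · rw [mulSeries_toSeries, one_mul]

variable {β} in
/-- Expansions are compatible with products. -/
theorem IsConeExpansion.coneSer_mul [Finite J] [UniqueSums Λ] {h₁ h₂ : LatticeField Λ}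
    {F₁ F₂ F₃ : Λ → ℂ} {ν₁ ν₂ : Λ} (H₁ : IsConeExpansion β h₁ F₁) (H₂ : IsConeExpansion β h₂ F₂)
    (H₃ : IsConeExpansion β (h₁ * h₂) F₃) (hF₁ : F₁ ∈ coneSeries β ν₁ 0)
    (hF₂ : F₂ ∈ coneSeries β ν₂ 0) (hF₃ : F₃ ∈ coneSeries β (ν₁ + ν₂) 0) :
    coneSer β (ν₁ + ν₂) F₃ = coneSer β ν₁ F₁ * coneSer β ν₂ F₂ := by
  have hne : ∀ r : MvPolynomial J ℂ, MvPolynomial.constantCoeff r = 1 →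
      (r : MvPowerSeries J ℂ) ≠ 0 := by
    intro r hr
    rw [Ne, MvPolynomial.coe_eq_zero_iff]
    rintro rfl
    simp at hr
  obtain ⟨-, a₁, b₁, hb₁, e₁, e₁'⟩ := H₁
  obtain ⟨-, a₂, b₂, hb₂, e₂, e₂'⟩ := H₂
  obtain ⟨-, a₃, b₃, hb₃, e₃, e₃'⟩ := H₃
  obtain ⟨r₁, c₁, hr₁, h1, h1'⟩ := exists_normalForm β hF₁ hb₁ e₁ e₁'
  obtain ⟨r₂, c₂, hr₂, h2, h2'⟩ := exists_normalForm β hF₂ hb₂ e₂ e₂'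
  obtain ⟨r₃, c₃, hr₃, h3, h3'⟩ := exists_normalForm β hF₃ hb₃ e₃ e₃'
  -- The three normal forms are compared in the function field. The resulting polynomial identity is
  -- moved to power series, where the `r`'s cancel.
  have hc : c₁ * c₂ * r₃ = c₃ * (r₁ * r₂) := by
    apply conePoly_injective β
    apply mul_left_cancel₀ (zpoly_ne_zero (ν₁ + ν₂))
    apply IsFractionRing.injective _ (LatticeField Λ)
    change toField _ = toField _
    rw [← zpoly_mul_zpoly] at h3 ⊢
    simp only [toField, map_mul] at h1 h2 h3 ⊢
    linear_combination (-(algebraMap _ (LatticeField Λ) (zpoly ν₂)) *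
      algebraMap _ (LatticeField Λ) (conePoly β c₂) * algebraMap _ _ (conePoly β r₃)) * h1 -
      h₁ * algebraMap _ _ (conePoly β r₁) * algebraMap _ _ (conePoly β r₃) * h2 +
      algebraMap _ _ (conePoly β r₁) * algebraMap _ _ (conePoly β r₂) * h3
  have hc' : (c₁ : MvPowerSeries J ℂ) * c₂ * r₃ = c₃ * (r₁ * r₂) := by exact_mod_cast hc
  apply mul_left_cancel₀ (mul_ne_zero (mul_ne_zero (hne r₁ hr₁) (hne r₂ hr₂)) (hne r₃ hr₃))
  rw [← h1', ← h2', ← h3'] at hc'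
  linear_combination -hc'

theorem coneSer_coeff_mul_eq_zero {ν ν' : Λ} {F G : Λ → ℂ} {α : J →₀ ℕ}
    (hG : G ∈ coneSeries β ν (α.degree + 1)) :
    MvPowerSeries.coeff α (coneSer β ν' F * coneSer β ν G) = 0 := by
  classical
  rw [MvPowerSeries.coeff_mul]
  refine Finset.sum_eq_zero fun y hy => mul_eq_zero_of_right _ ?_
  have hy : y.1 + y.2 = α := Finset.HasAntidiagonal.mem_antidiagonal.1 hy
  refine coneSeries_apply_eq_zero β hG ?_
  rw [← hy, map_add]
  omega

/-- Truncation of a series to a Laurent polynomial. -/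
theorem exists_truncation [Finite J] {ν : Λ} {F : Λ → ℂ} (hF : F ∈ coneSeries β ν 0) (k : ℕ) :
    ∃ w : AddMonoidAlgebra ℂ Λ, toSeries w ∈ coneSeries β ν 0 ∧
      F - toSeries w ∈ coneSeries β ν k := by
  refine ⟨zpoly ν * conePoly β (MvPowerSeries.truncTotal k (coneSer β ν F)),
    toSeries_conePoly_mem β ν _, fun μ hμ => ?_⟩
  obtain ⟨α, rfl, -⟩ := sub_mem hF (toSeries_conePoly_mem β ν _) μ hμ
  refine ⟨α, rfl, ?_⟩
  by_contra! hk
  refine hμ ?_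
  rw [Pi.sub_apply, ← coeff_coneSer β ν F α, ← coeff_coneSer β ν (toSeries _) α, coneSer_toSeries_conePoly,
    MvPolynomial.coeff_coe, MvPowerSeries.coeff_truncTotal _ hk, sub_self]

/-- If a unipotent operator is on Laurent polynomials the expansion of an automorphism of the
function field, then it is multiplicative. -/
theorem IsUnipotentOn.coneSer_mulSeries [Finite J] [UniqueSums Λ] {Φ : (Λ → ℂ) → Λ → ℂ}
    (H : ∀ ν, IsUnipotentOn β ν Φ) {ψ : LatticeField Λ ≃ₐ[ℂ] LatticeField Λ}
    (hψ : ∀ x, IsConeExpansion β (ψ (toField x)) (Φ (toSeries x)))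
    {b : AddMonoidAlgebra ℂ Λ} {W : Λ → ℂ} {ν ν' : Λ} (hb : toSeries b ∈ coneSeries β ν' 0)
    (hW : W ∈ coneSeries β ν 0) :
    coneSer β (ν' + ν) (Φ (mulSeries b W)) =
      coneSer β ν' (Φ (toSeries b)) * coneSer β ν (Φ W) := by
  ext α
  -- The tail of `W` beyond the degree of `α` contributes to the coefficient at `α` on neither side,
  -- so `W` may be replaced by a Laurent polynomial.
  obtain ⟨w, hw, hWw⟩ := exists_truncation β hW (α.degree + 1)
  have hbw := mulSeries_mem_coneSeries β ν ν' hb hw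
  have hbW := mulSeries_mem_coneSeries β ν ν' hb hWw
  have hpoly : coneSer β (ν' + ν) (Φ (mulSeries b (toSeries w))) =
      coneSer β ν' (Φ (toSeries b)) * coneSer β ν (Φ (toSeries w)) := by
    refine (hψ b).coneSer_mul (hψ w) ?_ ((H ν').mem hb) ((H ν).mem hw) ((H (ν' + ν)).mem hbw)
    rw [mulSeries_toSeries, ← map_mul, toField, toField, ← map_mul]
    exact hψ (b * w)
  have hWeq : W = toSeries w + (W - toSeries w) := by abel
  have hWw0 := coneSeries_anti β ν (Nat.zero_le _) hWw
  have hbW0 := coneSeries_anti β (ν' + ν) (Nat.zero_le _) hbW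
  rw [hWeq, mulSeries_add_right, (H (ν' + ν)).map_add _ hbw _ hbW0, (H ν).map_add _ hw _ hWw0,
    _root_.map_add, _root_.map_add, _root_.map_add, mul_add, _root_.map_add, hpoly,
    coneSer_coeff_mul_eq_zero β ((H ν).mem hWw), coeff_coneSer,
    coneSeries_apply_eq_zero β ((H (ν' + ν)).mem hbW) (Nat.lt_succ_self _)]

/-- The expansions of the images under the inverse automorphism are the preimages under the
unipotent operator. -/
theorem IsUnipotentOn.exists_isConeExpansion_symm [Finite J] [UniqueSums Λ]
    {Φ : (Λ → ℂ) → Λ → ℂ} (H : ∀ ν, IsUnipotentOn β ν Φ)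
    {ψ : LatticeField Λ ≃ₐ[ℂ] LatticeField Λ}
    (hψ : ∀ x, IsConeExpansion β (ψ (toField x)) (Φ (toSeries x))) (x : AddMonoidAlgebra ℂ Λ) :
    ∃ W, Φ W = toSeries x ∧ IsConeExpansion β (ψ.symm (toField x)) W := by
  obtain ⟨a, b, hb, hab⟩ := IsFractionRing.div_surjective (A := AddMonoidAlgebra ℂ Λ)
    (ψ.symm (toField x))
  have hb := nonZeroDivisors.ne_zero hb
  obtain ⟨ν₁, hx⟩ := exists_toSeries_mem β x
  obtain ⟨ν₂, ha⟩ := exists_toSeries_mem β a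
  obtain ⟨ν', hb'⟩ := exists_toSeries_mem β b
  -- The translate `ν` is low enough for `x` to lie over `ν` and `a` over `ν' + ν`, where `b W` will
  -- lie.
  obtain ⟨ν, ⟨α₁, h₁⟩, α₂, h₂⟩ := exists_le_translate β ν₁ (ν₂ - ν')
  replace hx := coneSeries_translate β h₁ 0 hx
  replace ha : toSeries a ∈ coneSeries β (ν' + ν) 0 := by
    refine coneSeries_translate β (α := α₂) ?_ 0 ha
    rw [add_assoc, ← h₂, add_sub_cancel]
  obtain ⟨W, hW, hWx⟩ := (H ν).exists_eq hx
  have hab' : ψ.symm (toField x) * toField b = toField a := by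
    rw [← hab]
    exact div_mul_cancel₀ _ (FractionPullsBack.algebraMap_ne_zero hb)
  refine ⟨W, hWx, ⟨ν, hW⟩, a, b, hb, hab', ?_⟩
  have hbW := mulSeries_mem_coneSeries β ν ν' hb' hW
  -- It suffices that `Φ(b W) = Φ(a)`: the left side is `Φ(b) x` by multiplicativity, and both
  -- expand `ψ(b) x = ψ(a)`.
  refine (H (ν' + ν)).injOn hbW ha ?_
  refine coneSer_injOn β ((H (ν' + ν)).mem hbW) ((H (ν' + ν)).mem ha) ?_
  rw [IsUnipotentOn.coneSer_mulSeries β H hψ hb' hW, hWx]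
  refine ((hψ b).coneSer_mul (isConeExpansion_toSeries β x) ?_ ((H ν').mem hb') hx
    ((H (ν' + ν)).mem ha)).symm
  have := congrArg ψ hab'
  rw [map_mul, AlgEquiv.apply_symm_apply, mul_comm] at this
  rw [this]
  exact hψ a

end Product

/-! ## Iterated finite sums -/

section Finsum

variable {α β A : Type*} [AddCommMonoid A]

theorem finsum_comm_of_finite (F : α → β → A) (h : {x : α × β | F x.1 x.2 ≠ 0}.Finite) :
    ∑ᶠ a, ∑ᶠ b, F a b = ∑ᶠ b, ∑ᶠ a, F a b := by
  rw [← finsum_curry (fun x : α × β => F x.1 x.2) h, ← finsum_comp_equiv (Equiv.prodComm β α),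
    finsum_curry _ (h.preimage (Equiv.prodComm β α).injective.injOn)]
  rfl

theorem finsum_subtype_eq_finsum_ite (p : α → Prop) [DecidablePred p] (F : α → A) :
    ∑ᶠ a : {a // p a}, F a = ∑ᶠ a, if p a then F a else 0 := by
  rw [finsum_subtype_eq_finsum_cond]
  exact finsum_congr fun a => finsum_eq_if

theorem finsum_fiberwise (r : α → β) (F : α → A) (h : {a | F a ≠ 0}.Finite) :
    ∑ᶠ b, ∑ᶠ a : {a // r a = b}, F a = ∑ᶠ a, F a := by
  classical
  simp_rw [finsum_subtype_eq_finsum_ite]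
  rw [finsum_comm_of_finite]
  · refine finsum_congr fun a => ?_
    rw [finsum_eq_single _ (r a) fun b hb => if_neg hb.symm, if_pos rfl]
  · refine (h.image fun a => (r a, a)).subset ?_
    rintro ⟨b, a⟩ hab
    obtain ⟨h1, h2⟩ := ite_ne_right_iff.1 hab
    exact ⟨a, h2, Prod.ext h1 rfl⟩

end Finsum

/-! ## The folding map -/

section FoldMap

variable {I N Γ : Type*} [AddCommGroup N] [Group Γ] [MulAction Γ I]
variable (e : Module.Basis I ℤ N) (B : N →ₗ[ℤ] N →ₗ[ℤ] ℤ)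

theorem foldQ_basis (i : I) : foldQ Γ e (e i) = foldBasis Γ (orbitOf Γ i) := by
  rw [foldQ, Module.Basis.constr_basis]

variable [Finite I]

theorem foldSDual_apply_basis (m : Module.Dual ℤ N) (y : OrbitIndex Γ I) :
    foldSDual Γ e m (foldNoBasis Γ y) = ∑ᶠ i : {i : I // orbitOf Γ i = y}, m (e i) := by
  rw [foldSDual, LinearMap.dualMap_apply, foldS, Module.Basis.constr_basis]
  exact map_finsum m (Set.toFinite _)

theorem foldSDual_coord [DecidableEq I] [DecidableEq (OrbitIndex Γ I)] (i : I) :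
    foldSDual Γ e (e.dualBasis i) = (foldNoBasis Γ).dualBasis (orbitOf Γ i) := by
  refine (foldNoBasis Γ).ext fun y => ?_
  rw [foldSDual_apply_basis, finsum_subtype_eq_finsum_ite (fun i => orbitOf Γ i = y)
    (fun j => e.dualBasis i (e j)), finsum_eq_single _ i]
  · simp only [Module.Basis.dualBasis_apply_self]
    simp [eq_comm]
  · intro j hj
    simp [hj]

theorem coe_foldNoBasis (y : OrbitIndex Γ I) :
    ((foldNoBasis Γ y : FoldNo Γ I) : FoldN Γ I) = foldVec Γ y := by
  rw [foldNoBasis, Module.Basis.span_apply]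

/-- At `d_y e_y` the left side sums `{n, e_i}` over the orbit `y`; these are `d_y` equal terms by
the symmetry of the form. -/
theorem foldSDual_form
    (hB : ∀ (π π' : Γ) (i j : I), B (e (π • i)) (e (π' • j)) = B (e i) (e j)) (n : N) :
    foldSDual Γ e ((seedDatum e B).p n) = (foldDatum Γ e B).p (foldQ Γ e n) := by
  refine (foldNoBasis Γ).ext fun y => ?_
  rw [foldSDual_apply_basis]
  change ∑ᶠ i : {i : I // orbitOf Γ i = y}, B n (e i) =
    foldForm Γ e B (foldQ Γ e n) ((foldNoBasis Γ y : FoldNo Γ I) : FoldN Γ I)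
  have h1 : ∀ i : {i : I // orbitOf Γ i = y},
      B n (e i) = foldForm Γ e B (foldQ Γ e n) (foldBasis Γ y) := by
    rintro ⟨i, rfl⟩
    rw [← foldQ_basis e i, foldForm_foldQ Γ e B hB]
  rw [finsum_congr h1, coe_foldNoBasis, foldVec, map_smul, smul_eq_mul, orbitCard]
  have := Fintype.ofFinite {i : I // orbitOf Γ i = y}
  rw [finsum_eq_sum_of_fintype, Finset.sum_const, nsmul_eq_mul, Nat.card_eq_fintype_card]
  rfl

/-- Generators of `P` go to generators of `P̄`, so `φ^*` on series is the substitution of variables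
along `I ⊕ I → Ī ⊕ Ī`. -/
theorem foldSQ_coneBasis
    (hB : ∀ (π π' : Γ) (i j : I), B (e (π • i)) (e (π' • j)) = B (e i) (e j)) (j : I ⊕ I) :
    foldSQ Γ e ((seedDatum e B).coneBasis j) =
      (foldDatum Γ e B).coneBasis (Sum.map (orbitOf Γ) (orbitOf Γ) j) := by
  obtain i | i := j
  · rw [Sum.map_inl, LatticeDatum.coneBasis_inl, LatticeDatum.coneBasis_inl]
    let _ := Classical.decEq I
    let _ := Classical.decEq (OrbitIndex Γ I)
    exact Prod.ext (foldSDual_coord e i) (map_zero (foldQ Γ e))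
  · rw [Sum.map_inr, LatticeDatum.coneBasis_inr, LatticeDatum.coneBasis_inr]
    change (foldSDual Γ e ((seedDatum e B).p (e i)), foldQ Γ e (e i)) = _
    rw [foldSDual_form e B hB, foldQ_basis]
    rfl

theorem foldSQ_posVec
    (hB : ∀ (π π' : Γ) (i j : I), B (e (π • i)) (e (π' • j)) = B (e i) (e j)) (n : N) :
    foldSQ Γ e ((seedDatum e B).p n, n) = ((foldDatum Γ e B).p (foldQ Γ e n), foldQ Γ e n) := by
  rw [← foldSDual_form e B hB]
  rfl

theorem foldQ_mem_pos {n : N} (hn : n ∈ (seedDatum e B).pos) :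
    foldQ Γ e n ∈ (foldDatum Γ e B).pos := by
  obtain ⟨α, rfl⟩ := exists_coneHom_eq e hn.2
  have h1 := map_coneHom e (foldBasis Γ) (φ := (foldQ Γ e).toAddMonoidHom) (foldQ_basis e) α
  change foldQ Γ e (coneHom e α) = _ at h1
  rw [h1]
  refine ⟨fun h0 => hn.1 ?_, fun x => ?_⟩
  · have : (α.mapDomain (orbitOf Γ)).degree = 0 := by
      rw [coneHom_injective _ (h0.trans (map_zero (coneHom (foldBasis Γ))).symm), map_zero]
    rw [degree_mapDomain, Finsupp.degree_eq_zero_iff] at this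
    rw [this, map_zero]
  · exact (repr_coneHom (foldBasis Γ) _ x).symm ▸ Nat.cast_nonneg _

theorem finite_foldQ_fiber (x : FoldN Γ I) :
    Finite {n : (seedDatum e B).pos // foldQ Γ e n = x} := by
  classical
  -- The indicator of the cone in `N` turns finiteness of the fibre into a case of
  -- `finite_fiber_coneSeries`.
  let F : N → ℂ := fun n => if ∀ i, 0 ≤ e.repr n i then 1 else 0
  have hF : F ∈ coneSeries e 0 0 := by
    intro n hn
    obtain ⟨α, hα⟩ := exists_coneHom_eq e (ite_ne_right_iff.1 hn).1
    exact ⟨α, by rw [hα, zero_add], Nat.zero_le _⟩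
  have hfin := finite_fiber_coneSeries e (foldBasis Γ) (φ := (foldQ Γ e).toAddMonoidHom)
    (foldQ_basis e) hF x
  have := hfin.to_subtype
  refine Finite.of_injective (β := {μ | (foldQ Γ e).toAddMonoidHom μ = x ∧ F μ ≠ 0})
    (fun n => ⟨n.1, n.2, ?_⟩) fun n n' h => ?_
  · exact ite_ne_right_iff.2 ⟨n.1.2.2, one_ne_zero⟩
  · have h1 := congrArg Subtype.val h
    exact Subtype.ext (Subtype.ext h1)

end FoldMap

/-! ## Equivariance of the action -/

section FoldAct

variable {I N Γ : Type*} [AddCommGroup N] [Group Γ] [MulAction Γ I]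
variable (e : Module.Basis I ℤ N) (B : N →ₗ[ℤ] N →ₗ[ℤ] ℤ)

theorem repr_actN (π : Γ) (n : N) (i : I) : e.repr (actN Γ e π n) (π • i) = e.repr n i := by
  have h1 : (e.reindex (MulAction.toPerm π).symm).repr (actN Γ e π n) = e.repr n :=
    (e.reindex (MulAction.toPerm π).symm).repr.apply_symm_apply (e.repr n)
  have h2 := DFunLike.congr_fun h1 i
  simpa only [Module.Basis.repr_reindex_apply, Equiv.symm_symm, MulAction.toPerm_apply] using h2

theorem foldQ_actN (π : Γ) (n : N) : foldQ Γ e (actN Γ e π n) = foldQ Γ e n := by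
  have : foldQ Γ e ∘ₗ (actN Γ e π).toLinearMap = foldQ Γ e := e.ext fun i => by
    rw [LinearMap.comp_apply, LinearEquiv.coe_coe, actN, Module.Basis.equiv_apply,
      foldQ_basis, foldQ_basis]
    congr 1
    exact Quotient.sound (s := MulAction.orbitRel Γ I) ⟨π, rfl⟩
  exact LinearMap.congr_fun this n

variable [Finite I]

theorem foldQ_apply (n : N) (x : OrbitIndex Γ I) :
    foldQ Γ e n x = ∑ᶠ i : {i : I // orbitOf Γ i = x}, e.repr n i := by
  have := Fintype.ofFinite I
  classical
  rw [foldQ, Module.Basis.constr_apply_fintype, Finsupp.finsetSum_apply,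
    finsum_subtype_eq_finsum_ite (fun i => orbitOf Γ i = x) (fun j => e.repr n j),
    finsum_eq_sum_of_fintype]
  refine Finset.sum_congr rfl fun i _ => ?_
  rw [Finsupp.smul_apply, foldBasis, Finsupp.coe_basisSingleOne, Finsupp.single_apply]
  simp [Module.Basis.equivFun_apply]

theorem foldPairing_dualBasis [DecidableEq (OrbitIndex Γ I)] (v : FoldN Γ I)
    (x : OrbitIndex Γ I) :
    foldPairing Γ v ((foldNoBasis Γ).dualBasis x) = (v x : ℂ) / (orbitCard Γ x : ℂ) := by
  induction v using Finsupp.induction_linear with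
  | zero => simp
  | add v w hv hw =>
    rw [map_add, AddMonoidHom.add_apply, hv, hw, Finsupp.add_apply]
    push_cast
    rw [add_div]
  | single y a =>
    rw [foldPairing, Finsupp.liftAddHom_apply_single]
    change (a : ℂ) * (((foldNoBasis Γ).dualBasis x (foldNoBasis Γ y) : ℂ) / orbitCard Γ y) = _
    rw [Module.Basis.dualBasis_apply_self, Finsupp.single_apply]
    by_cases h : y = x
    · subst h
      simp [div_eq_mul_inv]
    · simp [h]

/-- For an invariant element of the Lie algebra, the sums over the fibres of `q` of the weighted
coordinates are constant on orbits. -/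
theorem sum_fiber_repr_smul {g : (seedDatum e B).ProGroup} (hg : g ∈ invariantGroup Γ e B)
    (x : FoldN Γ I) (π : Γ) (i : I) :
    ∑ᶠ n : {n : (seedDatum e B).pos // foldQ Γ e n = x}, g.log n * (e.repr (n : N) (π • i) : ℂ) =
      ∑ᶠ n : {n : (seedDatum e B).pos // foldQ Γ e n = x}, g.log n * (e.repr (n : N) i : ℂ) := by
  have := finite_foldQ_fiber (Γ := Γ) e B x
  -- `π⁻¹` permutes the fibre because `q` is invariant, and it preserves the coefficients because
  -- `g` is.
  let σ : {n : (seedDatum e B).pos // foldQ Γ e n = x} →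
      {n : (seedDatum e B).pos // foldQ Γ e n = x} :=
    fun n => ⟨⟨actN Γ e π⁻¹ n.1, actN_mem_pos Γ e B π⁻¹ n.1.2⟩, (foldQ_actN e π⁻¹ _).trans n.2⟩
  have hσ : Function.Injective σ := fun n n' h => by
    have h1 := congrArg Subtype.val (congrArg Subtype.val h)
    exact Subtype.ext (Subtype.ext ((actN Γ e π⁻¹).injective h1))
  refine finsum_eq_of_bijective σ (Finite.injective_iff_bijective.1 hσ) fun n => ?_
  have h1 : g.log (σ n).1 = g.log n.1 :=
    congrFun (congrArg LatticeDatum.ProGroup.log (hg π)) n.1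
  have h2 := repr_actN e π⁻¹ (n.1 : N) (π • i)
  rw [inv_smul_smul] at h2
  rw [h1]
  congr 2
  exact h2.symm

/-- The one place where invariance of `g` produces equivariance. Termwise the identity fails; summed
over the fibre, each coordinate may be replaced by its average over the orbit. -/
theorem sum_fiber_pairing {g : (seedDatum e B).ProGroup} (hg : g ∈ invariantGroup Γ e B)
    (x : (foldDatum Γ e B).pos) (m : Module.Dual ℤ N) :
    ∑ᶠ n : {n : (seedDatum e B).pos // foldQ Γ e n = x},
        g.log n * (seedDatum e B).pairing (n : N) m =
      (foldGroup Γ e B g).log x * (foldDatum Γ e B).pairing x (foldSDual Γ e m) := by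
  have := finite_foldQ_fiber (Γ := Γ) e B x
  have := Fintype.ofFinite {n : (seedDatum e B).pos // foldQ Γ e n = x}
  classical
  let L : Module.Dual ℤ N →+ ℂ := ∑ n : {n : (seedDatum e B).pos // foldQ Γ e n = x},
    (AddMonoidHom.mulLeft (g.log n)).comp ((seedDatum e B).pairing (n : N))
  let L' : Module.Dual ℤ N →+ ℂ := (AddMonoidHom.mulLeft ((foldGroup Γ e B g).log x)).comp
    (((foldDatum Γ e B).pairing x).comp (foldSDual Γ e).toAddMonoidHom)
  suffices L.toIntLinearMap = L'.toIntLinearMap by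
    have := LinearMap.congr_fun this m
    rw [finsum_eq_sum_of_fintype]
    simpa [L, L'] using this
  refine e.dualBasis.ext fun i => ?_
  change L (e.dualBasis i) = (foldGroup Γ e B g).log x *
    foldPairing Γ x (foldSDual Γ e (e.dualBasis i))
  rw [foldSDual_coord, foldPairing_dualBasis]
  have hL : L (e.dualBasis i) = ∑ᶠ n : {n : (seedDatum e B).pos // foldQ Γ e n = x},
      g.log n * (e.repr (n : N) i : ℂ) := by
    rw [finsum_eq_sum_of_fintype, AddMonoidHom.finsetSum_apply]
    refine Finset.sum_congr rfl fun n _ => ?_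
    change g.log n * ((e.dualBasis i (n : N) : ℤ) : ℂ) = _
    rw [Module.Basis.dualBasis_apply]
  have := Fintype.ofFinite {j : I // orbitOf Γ j = orbitOf Γ i}
  have hcard : (orbitCard Γ (orbitOf Γ i) : ℂ) ≠ 0 :=
    Nat.cast_ne_zero.2 (orbitCard_ne_zero Γ (orbitOf Γ i))
  rw [hL, ← mul_div_assoc, eq_div_iff hcard]
  -- The coordinate of `x = q n` at an orbit is the sum of those of `n` over the orbit; the two sums
  -- are exchanged.
  have hx : (foldGroup Γ e B g).log x * (((x : FoldN Γ I) (orbitOf Γ i) : ℤ) : ℂ) =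
      ∑ j : {j : I // orbitOf Γ j = orbitOf Γ i},
        ∑ᶠ n : {n : (seedDatum e B).pos // foldQ Γ e n = x},
          g.log n * (e.repr (n : N) j : ℂ) := by
    simp_rw [finsum_eq_sum_of_fintype]
    rw [Finset.sum_comm]
    change (∑ᶠ n : {n : (seedDatum e B).pos // foldQ Γ e n = x}, g.log n) * _ = _
    rw [finsum_eq_sum_of_fintype, Finset.sum_mul]
    refine Finset.sum_congr rfl fun n _ => ?_
    rw [← Finset.mul_sum, ← Int.cast_sum, ← finsum_eq_sum_of_fintype, ← foldQ_apply, n.2]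
  rw [hx, Finset.sum_congr rfl (g := fun _ => ∑ᶠ n : {n : (seedDatum e B).pos // foldQ Γ e n = x},
    g.log n * (e.repr (n : N) i : ℂ)), Finset.sum_const, nsmul_eq_mul, mul_comm, orbitCard,
    Nat.card_eq_fintype_card, Finset.card_univ]
  rintro ⟨j, hj⟩ -
  obtain ⟨π, rfl⟩ := Quotient.exact (s := MulAction.orbitRel Γ I) hj
  exact sum_fiber_repr_smul e B hg x π i

theorem finite_fiber_support {J J' Λ Λ' ι : Type*} [AddCommGroup Λ] [AddCommGroup Λ'] [Finite J]
    (β : Module.Basis J ℤ Λ) (β' : Module.Basis J' ℤ Λ') {φ : Λ →+ Λ'} {o : J → J'}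
    (hφ : ∀ j, φ (β j) = β' (o j)) {ν : Λ} {G : ι → Λ → ℂ}
    (hG : ∀ i, G i ∈ coneSeries β ν 0) (hfin : ∀ μ, {i | G i μ ≠ 0}.Finite) (x : Λ') :
    {y : {μ : Λ // φ μ = x} × ι | G y.2 y.1 ≠ 0}.Finite := by
  classical
  -- The indicator of the translated cone bounds all the supports of the `G i` at once.
  let K : Λ → ℂ := fun μ => if ∃ α, μ = ν + coneHom β α then 1 else 0
  have hK : K ∈ coneSeries β ν 0 := fun μ hμ =>
    (ite_ne_right_iff.1 hμ).1.imp fun _ h => ⟨h, Nat.zero_le _⟩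
  have hA := (finite_fiber_coneSeries β β' hφ hK x).preimage
    (Subtype.val_injective (p := fun μ : Λ => φ μ = x)).injOn
  refine (hA.biUnion fun μ _ => (hfin μ).image fun i => (μ, i)).subset ?_
  rintro ⟨μ, i⟩ h
  refine Set.mem_biUnion (x := μ) ⟨μ.2, ?_⟩ ⟨i, h, rfl⟩
  exact ite_ne_right_iff.2 ⟨(hG i μ h).imp fun _ h' => h'.1, one_ne_zero⟩

theorem lieAct_pushSeries
    (hB : ∀ (π π' : Γ) (i j : I), B (e (π • i)) (e (π' • j)) = B (e i) (e j))
    {g : (seedDatum e B).ProGroup} (hg : g ∈ invariantGroup Γ e B)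
    {ν : Module.Dual ℤ N × N} {F : Module.Dual ℤ N × N → ℂ}
    (hF : F ∈ coneSeries (seedDatum e B).coneBasis ν 0) :
    (foldDatum Γ e B).lieAct (foldGroup Γ e B g).log (pushSeries (foldSQ Γ e) F) =
      pushSeries (foldSQ Γ e) ((seedDatum e B).lieAct g.log F) := by
  let T := seedDatum e B
  let T' := foldDatum Γ e B
  have hφ := foldSQ_coneBasis (Γ := Γ) e B hB
  ext x
  let S : T.pos → {μ // foldSQ Γ e μ = x} → ℂ := fun n μ =>
    g.log n * T.pairing n (μ.1.1 - T.p n) * F (μ - (T.p n, (n : N)))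
  have hS : {y : {μ // foldSQ Γ e μ = x} × T.pos | S y.2 y.1 ≠ 0}.Finite := by
    refine (finite_fiber_support T.coneBasis T'.coneBasis hφ (ν := ν)
      (G := fun (n : T.pos) μ => F (μ - (T.p n, (n : N)))) (fun n μ hμ => ?_)
      (T.finite_lieAct_support hF) x).subset fun y hy => right_ne_zero_of_mul hy
    obtain ⟨α, h1, -⟩ := hF _ hμ
    obtain ⟨γ, h2, -⟩ := T.exists_coneHom_of_pos n
    exact ⟨α + γ, by rw [map_add, ← add_assoc, ← h1, ← h2, sub_add_cancel], Nat.zero_le _⟩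
  have hS' : {n | ∑ᶠ μ, S n μ ≠ 0}.Finite := by
    refine (hS.image Prod.snd).subset fun n hn => ?_
    obtain ⟨μ, hμ⟩ : ∃ μ, S n μ ≠ 0 := by
      by_contra! h
      exact hn (finsum_eq_zero_of_forall_eq_zero h)
    exact ⟨(μ, n), hμ, rfl⟩
  let r : T.pos → T'.pos := fun n => ⟨foldQ Γ e n, foldQ_mem_pos e B n.2⟩
  -- With `κ = μ - (p n, n)` the range of `κ` depends only on `n'`, and `n` enters only through
  -- `g.log n * ⟨n, κ.1⟩`, which `sum_fiber_pairing` sums.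
  have hfib : ∀ n' : T'.pos, (foldGroup Γ e B g).log n' * T'.pairing n' (x.1 - T'.p n') *
      pushSeries (foldSQ Γ e) F (x - (T'.p n', (n' : FoldN Γ I))) =
        ∑ᶠ n : {n : T.pos // foldQ Γ e n = n'}, ∑ᶠ μ, S n μ := by
    intro n'
    have hfin := finite_foldQ_fiber (Γ := Γ) e B n'
    have h1 : ∀ n : {n : T.pos // foldQ Γ e n = n'}, ∑ᶠ μ, S n μ =
        ∑ᶠ κ : {κ // foldSQ Γ e κ = x - (T'.p n', (n' : FoldN Γ I))},
          g.log n * T.pairing (n : N) κ.1.1 * F κ := by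
      intro n
      have h2 : foldSQ Γ e (T.p n, (n : N)) = (T'.p n', (n' : FoldN Γ I)) := by
        rw [foldSQ_posVec e B hB, n.2]
      let E : {μ // foldSQ Γ e μ = x} ≃
          {κ // foldSQ Γ e κ = x - (T'.p n', (n' : FoldN Γ I))} :=
        (Equiv.subRight (T.p n, (n : N))).subtypeEquiv fun μ => by
          rw [Equiv.subRight_apply, map_sub, h2, sub_left_inj]
      rw [← finsum_comp_equiv E]
      rfl
    rw [finsum_congr h1, finsum_comm_of_finite, pushSeries, mul_finsum]
    · refine finsum_congr fun κ => ?_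
      rw [← finsum_mul, sum_fiber_pairing e B hg]
      have h3 : foldSDual Γ e κ.1.1 = x.1 - T'.p n' := congrArg Prod.fst κ.2
      rw [h3]
    · have h4 := (finite_fiber_coneSeries _ _ hφ hF (x - (T'.p n', (n' : FoldN Γ I)))).preimage
        (Subtype.val_injective
          (p := fun κ => foldSQ Γ e κ = x - (T'.p n', (n' : FoldN Γ I)))).injOn
      refine ((Set.finite_univ (α := {n : T.pos // foldQ Γ e n = n'})).prod h4).subset ?_
      rintro ⟨n, κ⟩ h
      exact ⟨trivial, κ.2, right_ne_zero_of_mul h⟩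
  calc T'.lieAct (foldGroup Γ e B g).log (pushSeries (foldSQ Γ e) F) x
      = ∑ᶠ n' : T'.pos, ∑ᶠ n : {n : T.pos // r n = n'}, ∑ᶠ μ, S n μ := by
        rw [LatticeDatum.lieAct_apply]
        refine finsum_congr fun n' => ?_
        rw [hfib n', ← finsum_comp_equiv (Equiv.subtypeEquivRight fun n => Subtype.ext_iff.symm)]
        rfl
    _ = ∑ᶠ n, ∑ᶠ μ, S n μ := finsum_fiberwise r _ hS'
    _ = ∑ᶠ μ, ∑ᶠ n, S n μ := (finsum_comm_of_finite (fun μ n => S n μ) hS).symm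
    _ = pushSeries (foldSQ Γ e) (T.lieAct g.log F) x := rfl

theorem lieAct_iterate_pushSeries
    (hB : ∀ (π π' : Γ) (i j : I), B (e (π • i)) (e (π' • j)) = B (e i) (e j))
    {g : (seedDatum e B).ProGroup} (hg : g ∈ invariantGroup Γ e B)
    {ν : Module.Dual ℤ N × N} {F : Module.Dual ℤ N × N → ℂ}
    (hF : F ∈ coneSeries (seedDatum e B).coneBasis ν 0) (k : ℕ) :
    ((foldDatum Γ e B).lieAct (foldGroup Γ e B g).log)^[k] (pushSeries (foldSQ Γ e) F) =
      pushSeries (foldSQ Γ e) (((seedDatum e B).lieAct g.log)^[k] F) := by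
  induction k with
  | zero => rfl
  | succ k ih =>
    rw [Function.iterate_succ_apply', ih, Function.iterate_succ_apply']
    exact lieAct_pushSeries e B hB hg (coneSeries_anti _ _ (Nat.zero_le _)
      ((seedDatum e B).lieAct_iterate_mem g.log hF k))

theorem act_pushSeries
    (hB : ∀ (π π' : Γ) (i j : I), B (e (π • i)) (e (π' • j)) = B (e i) (e j))
    {g : (seedDatum e B).ProGroup} (hg : g ∈ invariantGroup Γ e B)
    {ν : Module.Dual ℤ N × N} {F : Module.Dual ℤ N × N → ℂ}
    (hF : F ∈ coneSeries (seedDatum e B).coneBasis ν 0) :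
    (foldDatum Γ e B).act (foldGroup Γ e B g) (pushSeries (foldSQ Γ e) F) =
      pushSeries (foldSQ Γ e) ((seedDatum e B).act g F) := by
  ext x
  simp only [LatticeDatum.act, pushSeries]
  rw [finsum_comm_of_finite]
  · refine finsum_congr fun k => ?_
    rw [lieAct_iterate_pushSeries e B hB hg hF, pushSeries, mul_finsum]
  · refine (finite_fiber_support _ _ (foldSQ_coneBasis (Γ := Γ) e B hB)
      (G := fun k => ((seedDatum e B).lieAct g.log)^[k] F)
      (fun k => coneSeries_anti _ ν (Nat.zero_le _)
        ((seedDatum e B).lieAct_iterate_mem g.log hF k))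
      ((seedDatum e B).finite_act_support g.log hF) x).subset fun y hy => right_ne_zero_of_mul hy

end FoldAct

theorem proposition3p3 {I N Γ : Type*} [Finite I] [AddCommGroup N] [Group Γ] [MulAction Γ I]
    (e : Module.Basis I ℤ N) (B : N →ₗ[ℤ] N →ₗ[ℤ] ℤ)
    (hskew : ∀ n n' : N, B n n' = -B n' n)
    (hB : ∀ (π π' : Γ) (i j : I), B (e (π • i)) (e (π' • j)) = B (e i) (e j))
    (g : (seedDatum e B).ProGroup) (hg : g ∈ invariantGroup Γ e B)
    (ψ : LatticeField (Module.Dual ℤ N × N) ≃ₐ[ℂ] LatticeField (Module.Dual ℤ N × N))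
    (hψ : (seedDatum e B).Induces g ψ) :
    ∃ ψ' : LatticeField (FoldMo Γ I × FoldN Γ I) ≃ₐ[ℂ] LatticeField (FoldMo Γ I × FoldN Γ I),
      (foldDatum Γ e B).Induces (foldGroup Γ e B g) ψ' ∧
      (∀ μ : Module.Dual ℤ N × N,
        (foldDatum Γ e B).act (foldGroup Γ e B g) (toSeries (zpoly (foldSQ Γ e μ))) =
          pullSeries Γ e ((seedDatum e B).act g (toSeries (zpoly μ)))) ∧
      (∀ (h : LatticeField (Module.Dual ℤ N × N)) (h' : LatticeField (FoldMo Γ I × FoldN Γ I)),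
        PullsBackTo Γ e h h' → PullsBackTo Γ e (ψ h) (ψ' h')) := by
  have hφ := foldSQ_coneBasis (Γ := Γ) e B hB
  set β := (seedDatum e B).coneBasis
  set β' := (foldDatum Γ e B).coneBasis
  have := β.uniqueSums
  have := β'.uniqueSums
  have ho : Function.Surjective (Sum.map (orbitOf Γ) (orbitOf Γ) : I ⊕ I → _) :=
    Function.Surjective.sumMap Quotient.mk_surjective Quotient.mk_surjective
  have hp := mapDomainRingHom_surjective (map_surjective β β' hφ ho)
  have hψ₁ : ∀ x, IsConeExpansion β (ψ (toField x)) ((seedDatum e B).act g (toSeries x)) :=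
    fun x => (seedDatum e B).isExpansion_iff.1 (hψ x)
  have hact : ∀ F, (∃ ν, F ∈ coneSeries β ν 0) →
      (foldDatum Γ e B).act (foldGroup Γ e B g) (pushSeries (foldSQ Γ e) F) =
        pushSeries (foldSQ Γ e) ((seedDatum e B).act g F) :=
    fun F hF => act_pushSeries e B hB hg hF.choose_spec
  have hU := fun ν => (foldDatum Γ e B).act_isUnipotentOn (foldGroup Γ e B g) ν
  -- Injectivity of `ḡ` on series gives the vanishing criterion needed for `ψ` and, applied to
  -- preimages under `g`, for `ψ⁻¹`.
  have hact0 : ∀ F, (∃ ν, F ∈ coneSeries β ν 0) →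
      (pushSeries (foldSQ Γ e) ((seedDatum e B).act g F) = 0 ↔ pushSeries (foldSQ Γ e) F = 0) := by
    intro F hF
    have hz : (foldDatum Γ e B).act (foldGroup Γ e B g) 0 = 0 := by
      simpa using (hU 0).map_sub (zero_mem _) (zero_mem _)
    rw [← hact F hF]
    obtain ⟨ν, hF⟩ := hF
    refine ⟨fun h => (hU (foldSQ Γ e ν)).injOn (pushSeries_mem_coneSeries β β' hφ hF)
      (zero_mem _) (h.trans hz.symm), fun h => ?_⟩
    rw [h, hz]
  have hpoly0 : ∀ x : AddMonoidAlgebra ℂ (Module.Dual ℤ N × N),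
      pushSeries (foldSQ Γ e) (toSeries x) = 0 ↔
        AddMonoidAlgebra.mapDomainRingHom ℂ (foldSQ Γ e) x = 0 := by
    intro x
    rw [pushSeries_toSeries]
    exact ⟨fun h => toSeries_injective h, fun h => by rw [h]; rfl⟩
  obtain ⟨ψ', hψ'⟩ := FractionPullsBack.exists_algEquiv (k := ℂ) (ψ := ψ)
    (p := AddMonoidAlgebra.mapDomainAlgHom ℂ ℂ (foldSQ Γ e)) hp
    (fun x => by
      obtain ⟨h', h1, h2⟩ := (hψ₁ x).exists_pullsBack β' hφ
      refine ⟨h', h1, h2.eq_zero_iff.trans ?_⟩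
      exact (hact0 _ (exists_toSeries_mem β x)).trans (hpoly0 x))
    (fun x => by
      obtain ⟨W, hW, hWx⟩ := IsUnipotentOn.exists_isConeExpansion_symm β
        (fun ν => (seedDatum e B).act_isUnipotentOn g ν) hψ₁ x
      obtain ⟨h', h1, h2⟩ := hWx.exists_pullsBack β' hφ
      refine ⟨h', h1, h2.eq_zero_iff.trans ?_⟩
      rw [← hact0 W hWx.1, hW]
      exact hpoly0 x)
  refine ⟨ψ', fun x' => ?_, fun μ => ?_, hψ'⟩
  -- Every Laurent polynomial on the subtorus is some `φ^* x`; the restriction of `ψ(x)` is unique,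
  -- so it is `ψ'(φ^* x)` and has the pushed series as expansion.
  · obtain ⟨x, rfl⟩ := hp x'
    rw [LatticeDatum.isExpansion_iff, ← pushSeries_toSeries, hact _ (exists_toSeries_mem β x)]
    obtain ⟨h', h1, h2⟩ := (hψ₁ x).exists_pullsBack β' hφ
    have h3 := hψ' _ _ (FractionPullsBack.of _ x)
    have h4 := h3.unique h1
    rw [← h4] at h2
    exact h2
  · have h1 := pushSeries_toSeries (foldSQ Γ e) (zpoly μ)
    rw [zpoly, mapDomainRingHom_single] at h1
    rw [zpoly, ← h1]
    exact hact _ (exists_toSeries_mem β (zpoly μ))
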